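/- **Setting.** There are $N$ base stations (BS) with $N_T$ antennas, a RIS with $N_R$ elements and a user (UE) with $N_U$ antennas, all carrying uniform linear arrays in the plane. BS $n$ uses the subcarriers $j\in\{n,n+N,\dots,n+(N_S-1)N\}$ and sends $M$ pilot beams $w_n[j,m]\in\mathbb C^{N_T}$ on each. With $\Theta=\mathrm{diag}(e^{i\theta_1},\dots,e^{i\theta_{N_R}})$ the UE receives, in a given slot, $$y_n[j,m]=H_n[j]\,\Theta\,G_n[j]\,w_n[j,m]+\text{noise}\in\mathbb C^{N_U},\qquad \text{noise}\sim\mathcal{CN}(0,\sigma_n^2I)\ \text{independent},\ \sigma_n^2>0,$$ $$G_n[j]=\sqrt{N_TN_R}\,A_{R}\,\mathrm{diag}\big(g_{l,n}e^{-2\pi i\frac{j}{N_ST_S}\tau^G_{l,n}}\big)_{0\le l\le L_1}A_{T}^H,\qquad H_n[j]=\sqrt{N_RN_U}\,A_{U}\,\mathrm{diag}\big(h_{l,n}e^{-2\pi i\frac{j}{N_ST_S}\tau^H_{l,n}}\big)_{0\le l\le L_2}A_{\bar R}^H .$$ The columns of $A_T,A_R,A_U,A_{\bar R}$ are steering vectors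 $\big(e^{-i\frac{d\pi}{\lambda_j}k\sin\vartheta}\big)_{k\ge0}$ with spacing $d=d_T,d_R,d_U,d_R$ and wavelength $\lambda_j$. Write $a_n$, $\phi_n$ for the known position and orientation of BS $n$; $b,x\in\mathbb R^2$ for the positions of RIS and UE; $\varphi,\omega$ for their orientations; $r_{l,n}$ ($1\le l\le L_1$) and $u_{l,n}$ ($1\le l\le L_2$) for the scatterers of the two hops; and put $\alpha(p)=\arccos(p_1/\|p\|)$. With $c$ the propagation speed, the delays and angles are - for $l=0$: $\tau^G=\|b-a_n\|/c$, $\vartheta_T=\alpha(b-a_n)-\phi_n$, $\vartheta_R=\pi+\alpha(b-a_n)-\varphi$; $\tau^H=\|x-b\|/c$, $\vartheta_U=\alpha(x-b)-\varphi$, $\vartheta_{\bar R}=\pi+\alpha(x-b)-\omega$; - for $l>0$: $\tau^G=(\|b-r_{l,n}\|+\|r_{l,n}-a_n\|)/c$, $\vartheta_T=\alpha(r_{l,n}-a_n)-\phi_n$, $\vartheta_R=\pi+\alpha(b-r_{l,n})-\varphi$; $\tau^H=(\|x-u_{l,n}\|+\|u_{l,n}-b\|)/c$, $\vartheta_U=\alpha(u_{l,n}-b)-\varphi$,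 $\vartheta_{\bar R}=\pi+\alpha(x-u_{l,n})-\omega$. Assume that no segment occurring here is parallel to the first axis. **The two models.** Let $\kappa_2$ and $\kappa_1$ be any two vectors of distinct real coordinates of $(b,x,\varphi,\omega,r,u)$, regarded as the unknown location parameters; all other coordinates are known (for instance $\kappa_2=(b,\omega,u)$ and $\kappa_1=(x,\varphi,r)$, or $\kappa_2=(x,\omega,u)$ and $\kappa_1=(b,\varphi,r)$). In the first model $g$ is given and $(\kappa_2,h)$ is unknown; in the second $h$ is given and $(\kappa_1,g)$ is unknown. "Given" may mean either that the whole matrices $G_n[j]$ (resp. $H_n[j]$) are known, or that only the gains are known while the geometry in that matrix varies with the unknown coordinates; the theorem holds in both readings. For an unknown $\rho=(\kappa',q)$ with complex gains $q$, regarded as the real vector $(\kappa',\mathrm{Re}\,q,\mathrm{Im}\,q)$, the Fisher information matrix is the matrix of second moments of the score (the gradient of the log-likelihood). An estimator $\hat\rho$ is called locally unbiased at $\rho$ if its mean exists near $\rho$, equals $\rho$ at $\rho$ and has Jacobian $I$ there (e.g. if it is unbiased near $\rho$). Let $\mathcal J(\kappa_2,h;w,\theta,g)$ and $\mathcal I(\kappa_1,g;w,\theta,h)$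 denote the Fisher information matrices of the two models. **Theorem 1.** 1. The noise-free signal, stacked over $(n,j,m,r)$, where $r$ is the index of the receive antenna, equals $\Gamma(\kappa_2,\theta,w,g)\,h=\Lambda(\kappa_1,\theta,w,h)\,g$, where $\Gamma$, $\Lambda$ are block diagonal in $n$. The $(l,n)$ entry of the row of $\Gamma$ is $\sum_t\mu_{l}^{(r,t)}(\Theta G_n[j]w_n[j,m])_t$, and that of $\Lambda$ is $\sum_{t,a}(H_n[j]\Theta)_{rt}\,\nu_{l}^{(t,a)}\,w_n[j,m]_a$, where $\mu_l^{(r,t)}$ and $\nu_l^{(t,a)}$ are the coefficients of $h_{l,n}$ in $H_n[j]_{rt}$ and of $g_{l,n}$ in $G_n[j]_{ta}$. 2. $\mathcal J$ is explicitly $$\mathcal J=\sum_{n,j,m,r}\frac{2}{\sigma_n^2}\,\mathrm{Re}\begin{bmatrix}\Xi h^*h^T\Xi^H&\Xi h^*\tilde\gamma\\ \tilde\gamma^Hh^T\Xi^H&\tilde\gamma^H\tilde\gamma\end{bmatrix},\qquad\tilde\gamma=[\gamma,\ i\gamma],$$ where $\gamma$ is the $(n,j,m,r)$ row of $\Gamma$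 and $\Xi$ has as columns the conjugated gradients in $\kappa_2$ of the entries of $\gamma$, in closed form by the derivatives of $\|p\|$ and $\alpha(p)$. The same formula holds for $\mathcal I$ with $\Lambda$, $g$ and the gradients $\Psi$ of the rows of $\Lambda$ in $\kappa_1$. 3. Whenever the Fisher information matrix is invertible, every locally unbiased estimator satisfies $$\mathbb E\big[\|\hat\rho-\rho\|^2\mid h,g\big]\ \ge\ \mathrm{CRLB}_1:=\mathrm{trace}\,\mathcal J(\kappa_2,h;w,\theta,g)^{-1},\qquad\text{resp.}\quad \ge\ \mathrm{CRLB}_2:=\mathrm{trace}\,\mathcal I(\kappa_1,g;w,\theta,h)^{-1}.$$ 4. Let $h$ be random with $h_{l,n}\sim\mathcal{CN}(0,\sigma_{l,n}^2)$, $\sigma^2_{l,n}>0$, any joint law with these marginals, and $\Sigma=\mathbb E[h^*h^T]$. Then $$\mathbb E_h\mathcal J=\sum_{n,j,m,r}\frac{2}{\sigma_n^2}\mathrm{Re}\begin{bmatrix}\Xi\Sigma\Xi^H&0\\0&\tilde\gamma^H\tilde\gamma\end{bmatrix}.$$ If $\mathcal J$ is almost surely invertible, then $\mathbb E_h\mathcal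 J$ is invertible, $\mathbb E_h[\mathcal J^{-1}]\succeq(\mathbb E_h\mathcal J)^{-1}$ (as quadratic forms, the left side possibly $+\infty$), and for every family $(\hat\rho_h)_h$ of estimators such that for almost every $h$ the estimator $\hat\rho_h$ is locally unbiased at $(\kappa_2,h)$ (in particular for a single estimator with this property), $$\mathrm{MSE}(w,\theta,g)=\mathbb E_{h,\text{noise}}\|\hat\rho_h-\rho\|^2\ \ge\ \mathbb E_h\,\mathrm{trace}\,\mathcal J^{-1}\ \ge\ \mathrm{trace}\,(\mathbb E_h\mathcal J)^{-1}.$$ The same holds for $\mathrm{MSE}(w,\theta,h)$ with $\mathcal I$, $\Lambda$, $\Psi$, $\mathbb E_g$ and $\Pi=\mathbb E[g^*g^T]$. -/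

import Mathlib

open MeasureTheory Filter Topology
open scoped Matrix ENNReal ComplexConjugate

noncomputable section

/-! ## Complex Gaussian observations, Fisher information, locally unbiased estimators -/

section Estimation

variable {I P : Type*} [Fintype I] [Fintype P] [DecidableEq P]

/-- Density, with respect to Lebesgue measure on `ℂ`, of the circularly symmetric complex normal
law `CN(m, v)` with mean `m` and variance `v > 0`. -/
def cnPDF (m : ℂ) (v : ℝ) (z : ℂ) : ℝ := (Real.pi * v)⁻¹ * Real.exp (-(‖z - m‖ ^ 2 / v))

/-- The law `CN(m, v)`. -/
def cnLaw (m : ℂ) (v : ℝ) : Measure ℂ :=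
  volume.withDensity fun z => ENNReal.ofReal (cnPDF m v z)

/-- Joint density of independent `CN(m i, v i)` entries. -/
def obsPDF (m : I → ℂ) (v : I → ℝ) (y : I → ℂ) : ℝ := ∏ i, cnPDF (m i) (v i) (y i)

/-- Law of the observation `y = m + noise` with independent `CN(0, v i)` noise entries. -/
def obsLaw (m : I → ℂ) (v : I → ℝ) : Measure (I → ℂ) :=
  volume.withDensity fun y => ENNReal.ofReal (obsPDF m v y)

/-- The score: partial derivative of the log-likelihood in the real parameter `p`. -/
def score (m : (P → ℝ) → I → ℂ) (v : I → ℝ) (ρ : P → ℝ) (y : I → ℂ) (p : P) : ℝ :=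
  deriv (fun s => Real.log (obsPDF (m (Function.update ρ p s)) v y)) (ρ p)

/-- Fisher information matrix: second moments of the score at the true parameter. -/
def fisher (m : (P → ℝ) → I → ℂ) (v : I → ℝ) (ρ : P → ℝ) : Matrix P P ℝ :=
  Matrix.of fun p q => ∫ y, score m v ρ y p * score m v ρ y q ∂(obsLaw (m ρ) v)

/-- `est` is a (measurable) estimator of the whole parameter vector which is unbiased to first order
at `ρ`: its mean exists near `ρ`, equals `ρ` at `ρ`, and has the identity as its Jacobian there.
Every estimator that is unbiased on a neighbourhood of `ρ` has this property. -/
structure LocallyUnbiased (m : (P → ℝ) → I → ℂ) (v : I → ℝ) (ρ : P → ℝ)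
    (est : (I → ℂ) → P → ℝ) : Prop where
  measurable : Measurable est
  integrable : ∀ᶠ ρ' in 𝓝 ρ, ∀ p, Integrable (fun y => est y p) (obsLaw (m ρ') v)
  mean_eq : ∀ p, ∫ y, est y p ∂(obsLaw (m ρ) v) = ρ p
  deriv_eq : ∀ p q, HasDerivAt
    (fun s => ∫ y, est y p ∂(obsLaw (m (Function.update ρ q s)) v)) (if p = q then 1 else 0) (ρ q)

/-- Mean squared error `E ‖ρ̂ - ρ‖²` at the true parameter `ρ`, as an extended nonnegative real. -/
def mse (m : (P → ℝ) → I → ℂ) (v : I → ℝ) (ρ : P → ℝ) (est : (I → ℂ) → P → ℝ) : ℝ≥0∞ :=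
  ∫⁻ y, ENNReal.ofReal (∑ p, (est y p - ρ p) ^ 2) ∂(obsLaw (m ρ) v)

end Estimation

/-! ## Geometry -/

/-- The location coordinates: RIS position, UE position, RIS orientation, UE orientation, and the
scatterer positions of the BS-RIS and of the RIS-UE hop (scatterer `l`, base station `n`). -/
inductive Coord (N L₁ L₂ : ℕ) : Type
  | ris (i : Fin 2)
  | ue (i : Fin 2)
  | risRot
  | ueRot
  | scatG (l : Fin L₁) (n : Fin N) (i : Fin 2)
  | scatH (l : Fin L₂) (n : Fin N) (i : Fin 2)
  deriving DecidableEq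

/-- The points of the plane that propagation paths run through. -/
inductive Pt (N L₁ L₂ : ℕ) : Type
  | bs (n : Fin N)
  | ris
  | ue
  | scatG (l : Fin L₁) (n : Fin N)
  | scatH (l : Fin L₂) (n : Fin N)

/-- Known constants: base station positions and orientations, propagation speed, sampling period,
element spacings of the BS, RIS and UE arrays, and wavelength of each subcarrier. -/
structure RISSystem (N : ℕ) where
  bs : Fin N → EuclideanSpace ℝ (Fin 2)
  bsRot : Fin N → ℝ
  c : ℝ
  Ts : ℝ
  dT : ℝ
  dR : ℝ
  dU : ℝ
  wavelength : ℕ → ℝ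

/-- Channel gains are indexed by the base station and the path (path `0` is the direct one). -/
abbrev GainIdx (N L : ℕ) := Fin N × Fin (L + 1)

/-- Received samples: base station, subcarrier (among those of that station), pilot symbol, antenna. -/
abbrev Obs (N NS M NU : ℕ) := Fin N × Fin NS × Fin M × Fin NU

/-- Noise variances: one for each base station. -/
def noiseVar {N NS M NU : ℕ} (σsq : Fin N → ℝ) : Obs N NS M NU → ℝ := fun i => σsq i.1

/-- The `s`-th subcarrier of base station `n` in the list `n, n + N, …, n + (NS - 1) N`, where base
stations are numbered from `1`. -/
def subcarrier {N NS : ℕ} (n : Fin N) (s : Fin NS) : ℕ := (n : ℕ) + 1 + (s : ℕ) * N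

section Geometry

variable {N L₁ L₂ : ℕ} (S : RISSystem N) (κ : Coord N L₁ L₂ → ℝ)

def Pt.pos : Pt N L₁ L₂ → EuclideanSpace ℝ (Fin 2)
  | .bs n => S.bs n
  | .ris => WithLp.toLp 2 fun i => κ (.ris i)
  | .ue => WithLp.toLp 2 fun i => κ (.ue i)
  | .scatG l n => WithLp.toLp 2 fun i => κ (.scatG l n i)
  | .scatH l n => WithLp.toLp 2 fun i => κ (.scatH l n i)

/-- Displacement from `Q` to `P`. -/
def disp (P Q : Pt N L₁ L₂) : EuclideanSpace ℝ (Fin 2) := P.pos S κ - Q.pos S κ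

def len (P Q : Pt N L₁ L₂) : ℝ := ‖disp S κ P Q‖

/-- Angle of the displacement with the first coordinate axis. -/
def ang (P Q : Pt N L₁ L₂) : ℝ := Real.arccos (disp S κ P Q 0 / ‖disp S κ P Q‖)

/-- Times of arrival on the BS-RIS hop. -/
def toaG (n : Fin N) : Fin (L₁ + 1) → ℝ :=
  Fin.cases (len S κ .ris (.bs n) / S.c)
    fun l => (len S κ .ris (.scatG l n) + len S κ (.scatG l n) (.bs n)) / S.c

/-- Times of arrival on the RIS-UE hop. -/
def toaH (n : Fin N) : Fin (L₂ + 1) → ℝ :=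
  Fin.cases (len S κ .ue .ris / S.c)
    fun l => (len S κ .ue (.scatH l n) + len S κ (.scatH l n) .ris) / S.c

/-- The angles `θ_T`, `θ_R` of the BS-RIS hop. -/
def angT (n : Fin N) : Fin (L₁ + 1) → ℝ :=
  Fin.cases (ang S κ .ris (.bs n) - S.bsRot n) fun l => ang S κ (.scatG l n) (.bs n) - S.bsRot n

def angR (n : Fin N) : Fin (L₁ + 1) → ℝ :=
  Fin.cases (Real.pi + ang S κ .ris (.bs n) - κ .risRot)
    fun l => Real.pi + ang S κ .ris (.scatG l n) - κ .risRot

/-- The angles `θ_U`, `θ_R̄` of the RIS-UE hop. -/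
def angU (n : Fin N) : Fin (L₂ + 1) → ℝ :=
  Fin.cases (ang S κ .ue .ris - κ .risRot) fun l => ang S κ (.scatH l n) .ris - κ .risRot

def angRbar (n : Fin N) : Fin (L₂ + 1) → ℝ :=
  Fin.cases (Real.pi + ang S κ .ue .ris - κ .ueRot)
    fun l => Real.pi + ang S κ .ue (.scatH l n) - κ .ueRot

/-- No segment of a path is parallel to the first coordinate axis (in particular its ends differ):
this is where the arccosines above are differentiable. -/
def RegularGeometry : Prop :=
  disp S κ .ue .ris 1 ≠ 0 ∧
  (∀ n, disp S κ .ris (.bs n) 1 ≠ 0) ∧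
  (∀ l n, disp S κ .ris (.scatG l n) 1 ≠ 0 ∧ disp S κ (.scatG l n) (.bs n) 1 ≠ 0) ∧
  (∀ l n, disp S κ .ue (.scatH l n) 1 ≠ 0 ∧ disp S κ (.scatH l n) .ris 1 ≠ 0)

/-! Closed forms of the partial derivatives of the above in a location coordinate `k`. -/

/-- The location coordinate which is the `i`-th coordinate of a point, if the point is not known. -/
def Pt.coord : Pt N L₁ L₂ → Fin 2 → Option (Coord N L₁ L₂)
  | .bs _, _ => none
  | .ris, i => some (.ris i)
  | .ue, i => some (.ue i)
  | .scatG l n, i => some (.scatG l n i)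
  | .scatH l n, i => some (.scatH l n i)

variable (k : Coord N L₁ L₂)

def dDisp (P Q : Pt N L₁ L₂) (i : Fin 2) : ℝ :=
  (if P.coord i = some k then 1 else 0) - (if Q.coord i = some k then 1 else 0)

def dLen (P Q : Pt N L₁ L₂) : ℝ :=
  ∑ i, disp S κ P Q i / ‖disp S κ P Q‖ * dDisp k P Q i

def dAng (P Q : Pt N L₁ L₂) : ℝ :=
  ∑ i, -(1 / √(1 - (disp S κ P Q 0 / ‖disp S κ P Q‖) ^ 2)) *
    (((if i = 0 then ‖disp S κ P Q‖ ^ 2 else 0) - disp S κ P Q i * disp S κ P Q 0) /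
      ‖disp S κ P Q‖ ^ 3) * dDisp k P Q i

def dToaG (n : Fin N) : Fin (L₁ + 1) → ℝ :=
  Fin.cases (dLen S κ k .ris (.bs n) / S.c)
    fun l => (dLen S κ k .ris (.scatG l n) + dLen S κ k (.scatG l n) (.bs n)) / S.c

def dToaH (n : Fin N) : Fin (L₂ + 1) → ℝ :=
  Fin.cases (dLen S κ k .ue .ris / S.c)
    fun l => (dLen S κ k .ue (.scatH l n) + dLen S κ k (.scatH l n) .ris) / S.c

def dAngT (n : Fin N) : Fin (L₁ + 1) → ℝ :=
  Fin.cases (dAng S κ k .ris (.bs n)) fun l => dAng S κ k (.scatG l n) (.bs n)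

def dAngR (n : Fin N) : Fin (L₁ + 1) → ℝ :=
  Fin.cases (dAng S κ k .ris (.bs n) - if k = .risRot then 1 else 0)
    fun l => dAng S κ k .ris (.scatG l n) - if k = .risRot then 1 else 0

def dAngU (n : Fin N) : Fin (L₂ + 1) → ℝ :=
  Fin.cases (dAng S κ k .ue .ris - if k = .risRot then 1 else 0)
    fun l => dAng S κ k (.scatH l n) .ris - if k = .risRot then 1 else 0

def dAngRbar (n : Fin N) : Fin (L₂ + 1) → ℝ :=
  Fin.cases (dAng S κ k .ue .ris - if k = .ueRot then 1 else 0)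
    fun l => dAng S κ k .ue (.scatH l n) - if k = .ueRot then 1 else 0

end Geometry

/-! ## Channels and received signal -/

/-- Entry `i` (counted from `0`) of the steering vector of a uniform linear array. -/
def steer (d lam ang : ℝ) (i : ℕ) : ℂ :=
  Complex.exp (-(Complex.I * ((d * Real.pi / lam * i * Real.sin ang : ℝ) : ℂ)))

section Channel

variable {N NS M NT NR NU L₁ L₂ : ℕ} (S : RISSystem N) (κ : Coord N L₁ L₂ → ℝ)
  (n : Fin N) (s : Fin NS)

/-- The phase rotation caused by the delay `τ` on a subcarrier. -/
def delayPhase (τ : ℝ) : ℂ :=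
  Complex.exp (-(Complex.I *
    ((2 * Real.pi * ((subcarrier n s : ℝ) / (NS * S.Ts)) * τ : ℝ) : ℂ)))

/-- The wavelength of the subcarrier. -/
def waveLen : ℝ := S.wavelength (subcarrier n s)

def steerT (NT : ℕ) : Matrix (Fin NT) (Fin (L₁ + 1)) ℂ :=
  Matrix.of fun i l => steer S.dT (waveLen S n s) (angT S κ n l) i

def steerR (NR : ℕ) : Matrix (Fin NR) (Fin (L₁ + 1)) ℂ :=
  Matrix.of fun i l => steer S.dR (waveLen S n s) (angR S κ n l) i

def steerU (NU : ℕ) : Matrix (Fin NU) (Fin (L₂ + 1)) ℂ :=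
  Matrix.of fun i l => steer S.dU (waveLen S n s) (angU S κ n l) i

def steerRbar (NR : ℕ) : Matrix (Fin NR) (Fin (L₂ + 1)) ℂ :=
  Matrix.of fun i l => steer S.dR (waveLen S n s) (angRbar S κ n l) i

/-- BS-RIS channel matrix with path gains `g`. -/
def chanG (NT NR : ℕ) (g : GainIdx N L₁ → ℂ) : Matrix (Fin NR) (Fin NT) ℂ :=
  steerR S κ n s NR *
    Matrix.diagonal (fun l => (√(NT * NR : ℝ) : ℂ) * (g (n, l) * delayPhase S n s (toaG S κ n l))) *
    (steerT S κ n s NT)ᴴ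

/-- RIS-UE channel matrix with path gains `h`. -/
def chanH (NR NU : ℕ) (h : GainIdx N L₂ → ℂ) : Matrix (Fin NU) (Fin NR) ℂ :=
  steerU S κ n s NU *
    Matrix.diagonal (fun l => (√(NR * NU : ℝ) : ℂ) * (h (n, l) * delayPhase S n s (toaH S κ n l))) *
    (steerRbar S κ n s NR)ᴴ

/-- The RIS reflection matrix for the phases `θ`. -/
def risMat (θ : Fin NR → ℝ) : Matrix (Fin NR) (Fin NR) ℂ :=
  Matrix.diagonal fun i => Complex.exp (Complex.I * (θ i : ℂ))

/-- Noise-free received signal `H Θ G w`; the location parameters of the RIS-UE channel `H` and of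
the BS-RIS channel `G` are separate arguments, so that one channel can be kept fixed. -/
def signal (θ : Fin NR → ℝ) (w : Fin N → Fin NS → Fin M → Fin NT → ℂ)
    (κH κG : Coord N L₁ L₂ → ℝ) (h : GainIdx N L₂ → ℂ) (g : GainIdx N L₁ → ℂ) :
    Obs N NS M NU → ℂ :=
  fun (n, s, m, r) =>
    ((chanH S κH n s NR NU h * risMat θ * chanG S κG n s NT NR g) *ᵥ w n s m) r

/-! Coefficients of the path gains, with their logarithmic derivatives in a location coordinate. -/

/-- Coefficient of `g (n, l)` in the entry `(i, a)` of `G`. -/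
def coefG (NT NR : ℕ) (l : Fin (L₁ + 1)) (i : Fin NR) (a : Fin NT) : ℂ :=
  (√(NT * NR : ℝ) : ℂ) * delayPhase S n s (toaG S κ n l) *
    steer S.dR (waveLen S n s) (angR S κ n l) i *
    conj (steer S.dT (waveLen S n s) (angT S κ n l) a)

/-- Coefficient of `h (n, l)` in the entry `(r, i)` of `H`. -/
def coefH (NR NU : ℕ) (l : Fin (L₂ + 1)) (r : Fin NU) (i : Fin NR) : ℂ :=
  (√(NR * NU : ℝ) : ℂ) * delayPhase S n s (toaH S κ n l) *
    steer S.dU (waveLen S n s) (angU S κ n l) r *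
    conj (steer S.dR (waveLen S n s) (angRbar S κ n l) i)

def logDG {NT NR : ℕ} (k : Coord N L₁ L₂) (l : Fin (L₁ + 1)) (i : Fin NR) (a : Fin NT) : ℂ :=
  Complex.I * ((
    - 2 * Real.pi * ((subcarrier n s : ℝ) / (NS * S.Ts)) * dToaG S κ k n l
    - S.dR * Real.pi / waveLen S n s * (i : ℕ) * Real.cos (angR S κ n l) * dAngR S κ k n l
    + S.dT * Real.pi / waveLen S n s * (a : ℕ) * Real.cos (angT S κ n l) * dAngT S κ k n l : ℝ) : ℂ)

def logDH {NR NU : ℕ} (k : Coord N L₁ L₂) (l : Fin (L₂ + 1)) (r : Fin NU) (i : Fin NR) : ℂ :=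
  Complex.I * ((
    - 2 * Real.pi * ((subcarrier n s : ℝ) / (NS * S.Ts)) * dToaH S κ k n l
    - S.dU * Real.pi / waveLen S n s * (r : ℕ) * Real.cos (angU S κ n l) * dAngU S κ k n l
    + S.dR * Real.pi / waveLen S n s * (i : ℕ) * Real.cos (angRbar S κ n l) * dAngRbar S κ k n l
    : ℝ) : ℂ)

/-- Partial derivative of `G` in the coordinate `k`. -/
def dChanG (NT NR : ℕ) (g : GainIdx N L₁ → ℂ) (k : Coord N L₁ L₂) : Matrix (Fin NR) (Fin NT) ℂ :=
  Matrix.of fun i a => ∑ l, g (n, l) * (coefG S κ n s NT NR l i a * logDG S κ n s k l i a)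

/-- Partial derivative of `H` in the coordinate `k`. -/
def dChanH (NR NU : ℕ) (h : GainIdx N L₂ → ℂ) (k : Coord N L₁ L₂) : Matrix (Fin NU) (Fin NR) ℂ :=
  Matrix.of fun r i => ∑ l, h (n, l) * (coefH S κ n s NR NU l r i * logDH S κ n s k l r i)

end Channel

/-! ## The two linear models and their explicit information matrices -/

section Models

variable {N NS M NT NR NU L₁ L₂ : ℕ} {ι : Type*} (S : RISSystem N)
  (θ : Fin NR → ℝ) (w : Fin N → Fin NS → Fin M → Fin NT → ℂ) (κ : Coord N L₁ L₂ → ℝ)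

/-- Real parameter vector `(κ', Re h, Im h)` made of location parameters and complex gains; its
Euclidean norm is that of `(κ', h)`. -/
def pack {ι Q : Type*} (κ' : ι → ℝ) (h : Q → ℂ) : ι ⊕ (Q ⊕ Q) → ℝ :=
  Sum.elim κ' (Sum.elim (fun p => (h p).re) fun p => (h p).im)

def gainsOf {ι Q : Type*} (ρ : ι ⊕ (Q ⊕ Q) → ℝ) (p : Q) : ℂ :=
  ⟨ρ (Sum.inr (Sum.inl p)), ρ (Sum.inr (Sum.inr p))⟩

/-- The location vector whose coordinates selected by `e` are taken from the parameter vector `ρ`,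
the other ones being kept at their true values `κ`. -/
def locOf {Q : Type*} (e : ι → Coord N L₁ L₂) (ρ : ι ⊕ Q → ℝ) : Coord N L₁ L₂ → ℝ :=
  Function.extend e (fun i => ρ (Sum.inl i)) κ

/-- Mean of the observation given `g`, as a function of the unknown `(κ₂, h)`; `κ₂` consists of the
coordinates selected by `e`. For `tied = false` the matrix `G` is known; for `tied = true` only its
gains `g` are known and its geometry follows the unknown coordinates. -/
def meanGivenG (e : ι → Coord N L₁ L₂) (tied : Bool) (g : GainIdx N L₁ → ℂ)
    (ρ : ι ⊕ (GainIdx N L₂ ⊕ GainIdx N L₂) → ℝ) : Obs N NS M NU → ℂ :=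
  signal S θ w (locOf κ e ρ) (if tied then locOf κ e ρ else κ) (gainsOf ρ) g

/-- Mean of the observation given `h`, as a function of the unknown `(κ₁, g)`. -/
def meanGivenH (e : ι → Coord N L₁ L₂) (tied : Bool) (h : GainIdx N L₂ → ℂ)
    (ρ : ι ⊕ (GainIdx N L₁ ⊕ GainIdx N L₁) → ℝ) : Obs N NS M NU → ℂ :=
  signal S θ w (if tied then locOf κ e ρ else κ) (locOf κ e ρ) h (gainsOf ρ)

/-- The matrix `Γ`, block diagonal in the base station index. -/
def gammaMat (g : GainIdx N L₁ → ℂ) : Matrix (Obs N NS M NU) (GainIdx N L₂) ℂ :=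
  Matrix.of fun (n, s, m, r) (n', l) =>
    if n' = n then
      ∑ i, coefH S κ n s NR NU l r i * ((risMat θ * chanG S κ n s NT NR g) *ᵥ w n s m) i
    else 0

/-- The matrix `Λ`, block diagonal in the base station index. -/
def lambdaMat (h : GainIdx N L₂ → ℂ) : Matrix (Obs N NS M NU) (GainIdx N L₁) ℂ :=
  Matrix.of fun (n, s, m, r) (n', l) =>
    if n' = n then
      ∑ i, (chanH S κ n s NR NU h * risMat θ) r i * ∑ a, coefG S κ n s NT NR l i a * w n s m a
    else 0

/-- The matrices `Ξ`: conjugated partial derivatives of a row of `Γ`. -/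
def xiMat (e : ι → Coord N L₁ L₂) (tied : Bool) (g : GainIdx N L₁ → ℂ) :
    Obs N NS M NU → Matrix ι (GainIdx N L₂) ℂ :=
  fun (n, s, m, r) => Matrix.of fun k (n', l) =>
    if n' = n then conj (
      ∑ i, coefH S κ n s NR NU l r i * logDH S κ n s (e k) l r i *
          ((risMat θ * chanG S κ n s NT NR g) *ᵥ w n s m) i +
      if tied then
        ∑ i, coefH S κ n s NR NU l r i *
          ((risMat θ * dChanG S κ n s NT NR g (e k)) *ᵥ w n s m) i
      else 0)
    else 0

/-- The matrices `Ψ`: conjugated partial derivatives of a row of `Λ`. -/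
def psiMat (e : ι → Coord N L₁ L₂) (tied : Bool) (h : GainIdx N L₂ → ℂ) :
    Obs N NS M NU → Matrix ι (GainIdx N L₁) ℂ :=
  fun (n, s, m, r) => Matrix.of fun k (n', l) =>
    if n' = n then conj (
      ∑ i, (chanH S κ n s NR NU h * risMat θ) r i *
          ∑ a, coefG S κ n s NT NR l i a * logDG S κ n s (e k) l i a * w n s m a +
      if tied then
        ∑ i, (dChanH S κ n s NR NU h (e k) * risMat θ) r i *
          ∑ a, coefG S κ n s NT NR l i a * w n s m a
      else 0)
    else 0

variable {I Q : Type*} [Fintype I] [Fintype Q]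

/-- The real matrix of a complex matrix acting on `(Re h, Im h)`. -/
def realify (A : Matrix Q Q ℂ) : Matrix (Q ⊕ Q) (Q ⊕ Q) ℝ :=
  Matrix.fromBlocks (A.map Complex.re) (-A.map Complex.im) (A.map Complex.im) (A.map Complex.re)

/-- The real matrix of `h ↦ Re (B h)` acting on `(Re h, Im h)`. -/
def realRow (B : Matrix ι Q ℂ) : Matrix ι (Q ⊕ Q) ℝ :=
  Matrix.fromCols (B.map Complex.re) (-B.map Complex.im)

/-- Explicit information matrix of the model `y = Γ(κ') h + noise` in the real coordinates
`(κ', Re h, Im h)`: sum over the samples of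
`(2 / v) Re [Ξ h* hᵀ Ξᴴ, Ξ h* γ; γᴴ hᵀ Ξᴴ, γᴴ γ]` with `γ` the row of `Γ`. -/
def explicitFIM (v : I → ℝ) (Γ : Matrix I Q ℂ) (Ξ : I → Matrix ι Q ℂ) (h : Q → ℂ) :
    Matrix (ι ⊕ (Q ⊕ Q)) (ι ⊕ (Q ⊕ Q)) ℝ :=
  ∑ i, (2 / v i) • Matrix.fromBlocks
    ((Ξ i * Matrix.vecMulVec (star h) h * (Ξ i)ᴴ).map Complex.re)
    (realRow (Matrix.vecMulVec (Ξ i *ᵥ star h) (Γ i)))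
    (realRow (Matrix.vecMulVec (Ξ i *ᵥ star h) (Γ i)))ᵀ
    (realify (Matrix.vecMulVec (star (Γ i)) (Γ i)))

/-- Explicit averaged information matrix, with second-moment matrix `C = E[h* hᵀ]` of the gains. -/
def averagedFIM (v : I → ℝ) (Γ : Matrix I Q ℂ) (Ξ : I → Matrix ι Q ℂ) (C : Matrix Q Q ℂ) :
    Matrix (ι ⊕ (Q ⊕ Q)) (ι ⊕ (Q ⊕ Q)) ℝ :=
  ∑ i, (2 / v i) • Matrix.fromBlocks
    ((Ξ i * C * (Ξ i)ᴴ).map Complex.re) 0 0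
    (realify (Matrix.vecMulVec (star (Γ i)) (Γ i)))

/-- `E[h* hᵀ]` for gains with law `ν`. -/
def secondMoment (ν : Measure (Q → ℂ)) : Matrix Q Q ℂ :=
  Matrix.of fun p q => ∫ h, conj (h p) * h q ∂ν

/-! The information matrices `J`, `I`, the bounds, the errors and the class of estimators of the two
models (`…J`, `…One`: given `g`; `…I`, `…Two`: given `h`), all at the true parameters. -/

variable [Fintype ι] [DecidableEq ι] (NU) (σsq : Fin N → ℝ) (e : ι → Coord N L₁ L₂) (tied : Bool)
  (g : GainIdx N L₁ → ℂ) (h : GainIdx N L₂ → ℂ)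

/-- Fisher information matrix of the unknown `(κ₂, Re h, Im h)` given `g`. -/
def fisherJ : Matrix (ι ⊕ (GainIdx N L₂ ⊕ GainIdx N L₂)) (ι ⊕ (GainIdx N L₂ ⊕ GainIdx N L₂)) ℝ :=
  fisher (meanGivenG (NU := NU) S θ w κ e tied g) (noiseVar σsq) (pack (κ ∘ e) h)

def crlbOne : ℝ := (fisherJ NU S θ w κ σsq e tied g h)⁻¹.trace

def UnbiasedOne (est : (Obs N NS M NU → ℂ) → ι ⊕ (GainIdx N L₂ ⊕ GainIdx N L₂) → ℝ) : Prop :=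
  LocallyUnbiased (meanGivenG S θ w κ e tied g) (noiseVar σsq) (pack (κ ∘ e) h) est

def mseOne (est : (Obs N NS M NU → ℂ) → ι ⊕ (GainIdx N L₂ ⊕ GainIdx N L₂) → ℝ) : ℝ≥0∞ :=
  mse (meanGivenG S θ w κ e tied g) (noiseVar σsq) (pack (κ ∘ e) h) est

/-- Closed form of `E J` for gains `h` with law `ν`. -/
def averagedJ (ν : Measure (GainIdx N L₂ → ℂ)) :
    Matrix (ι ⊕ (GainIdx N L₂ ⊕ GainIdx N L₂)) (ι ⊕ (GainIdx N L₂ ⊕ GainIdx N L₂)) ℝ :=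
  averagedFIM (noiseVar σsq) (gammaMat (NU := NU) S θ w κ g) (xiMat S θ w κ e tied g)
    (secondMoment ν)

/-- Fisher information matrix of the unknown `(κ₁, Re g, Im g)` given `h`. -/
def fisherI : Matrix (ι ⊕ (GainIdx N L₁ ⊕ GainIdx N L₁)) (ι ⊕ (GainIdx N L₁ ⊕ GainIdx N L₁)) ℝ :=
  fisher (meanGivenH (NU := NU) S θ w κ e tied h) (noiseVar σsq) (pack (κ ∘ e) g)

def crlbTwo : ℝ := (fisherI NU S θ w κ σsq e tied g h)⁻¹.trace

def UnbiasedTwo (est : (Obs N NS M NU → ℂ) → ι ⊕ (GainIdx N L₁ ⊕ GainIdx N L₁) → ℝ) : Prop :=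
  LocallyUnbiased (meanGivenH S θ w κ e tied h) (noiseVar σsq) (pack (κ ∘ e) g) est

def mseTwo (est : (Obs N NS M NU → ℂ) → ι ⊕ (GainIdx N L₁ ⊕ GainIdx N L₁) → ℝ) : ℝ≥0∞ :=
  mse (meanGivenH S θ w κ e tied h) (noiseVar σsq) (pack (κ ∘ e) g) est

/-- Closed form of `E I` for gains `g` with law `ν`. -/
def averagedI (ν : Measure (GainIdx N L₁ → ℂ)) :
    Matrix (ι ⊕ (GainIdx N L₁ ⊕ GainIdx N L₁)) (ι ⊕ (GainIdx N L₁ ⊕ GainIdx N L₁)) ℝ :=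
  averagedFIM (noiseVar σsq) (lambdaMat (NU := NU) S θ w κ h) (psiMat S θ w κ e tied h)
    (secondMoment ν)

end Models

end

noncomputable section

/-! ## The circular complex normal law -/

/-! Both models are instances of one abstract situation: a complex Gaussian observation whose mean
is linear in complex gains, with coefficients depending on real location parameters. Everything
statistical is proved in that generality (`linear_model_information_bounds`); the radio channel
enters only through the partial derivatives of the mean (`hasPartials_meanGivenG`,
`hasPartials_meanGivenH`).

The score is a sum of real-linear functions of the independent, centred, circular noise entries, so
its second moments are `∑ i, 2 / v i * Re (conj (D p i) * D q i)`, where `D` collects the partial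
derivatives of the mean (`fisher_eq_sum`). With `D` read off from `Γ` and `Ξ`, this is the explicit
block matrix (`explicitFIM_eq_sum`).

For the Cramér-Rao bound, the mean of a square integrable estimator is differentiated under the
integral sign (`hasDerivAt_integral_obsLaw`): all laws are written as densities against the law at
the true parameter, and Gaussian exponential moments dominate the difference quotients. Local
unbiasedness then fixes the covariances of the estimation error with the score, and the nonnegative
variance of the error minus a combination of scores gives each diagonal entry of the inverse
information matrix (`le_integral_sq_of_row`).

For random gains, the location-gain blocks are linear in the centred gains and average to zero,
while the location block is quadratic and only sees the second-moment matrix. The Jensen inequality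
comes from writing the form of `J⁻¹` at `z` as the supremum over `x` of `2 x·z - x·Jx`, which is
affine in `J`: integrating the member of this family that is optimal for the averaged matrix gives
the bound (`two_mul_dotProduct_sub_le_inv`). -/

theorem cnPDF_pos (m : ℂ) {v : ℝ} (hv : 0 < v) (z : ℂ) : 0 < cnPDF m v z := by
  unfold cnPDF; positivity

theorem continuous_cnPDF (m : ℂ) (v : ℝ) : Continuous (cnPDF m v) := by
  unfold cnPDF; fun_prop

theorem integral_cnLaw {m : ℂ} {v : ℝ} (hv : 0 < v) (f : ℂ → ℝ) :
    ∫ z, f z ∂(cnLaw m v) = ∫ z, cnPDF m v z * f z := by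
  unfold cnLaw
  rw [integral_withDensity_eq_integral_toReal_smul
    (continuous_cnPDF m v).measurable.ennreal_ofReal (by simp)]
  simp [ENNReal.toReal_ofReal (cnPDF_pos m hv _).le]

theorem integrable_cnLaw_iff {m : ℂ} {v : ℝ} (hv : 0 < v) (f : ℂ → ℝ) :
    Integrable f (cnLaw m v) ↔ Integrable fun z => cnPDF m v z * f z := by
  unfold cnLaw
  rw [integrable_withDensity_iff_integrable_smul'
    (continuous_cnPDF m v).measurable.ennreal_ofReal (by simp)]
  simp [ENNReal.toReal_ofReal (cnPDF_pos m hv _).le]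

theorem integral_exp_neg_sq_norm {v : ℝ} (hv : 0 < v) :
    ∫ z : ℂ, Real.exp (-(‖z‖ ^ 2 / v)) = Real.pi * v := by
  have := GaussianFourier.integral_rexp_neg_mul_sq_norm (V := ℂ) (inv_pos.2 hv)
  simp only [Complex.finrank_real_complex] at this
  norm_num at this
  rw [← this]
  congr 1 with z
  congr 1
  ring

theorem integral_cnPDF (m : ℂ) {v : ℝ} (hv : 0 < v) : ∫ z, cnPDF m v z = 1 := by
  have h : ∫ z, cnPDF m v z = ∫ z, cnPDF 0 v z := by
    rw [← integral_sub_right_eq_self (cnPDF 0 v) m]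
    simp [cnPDF]
  rw [h]
  simp only [cnPDF, sub_zero]
  rw [integral_const_mul, integral_exp_neg_sq_norm hv]
  exact inv_mul_cancel₀ (by positivity)

theorem integrable_cnPDF (m : ℂ) {v : ℝ} (hv : 0 < v) : Integrable (cnPDF m v) :=
  integrable_of_integral_eq_one (integral_cnPDF m hv)

theorem isProbabilityMeasure_cnLaw (m : ℂ) {v : ℝ} (hv : 0 < v) :
    IsProbabilityMeasure (cnLaw m v) := by
  constructor
  rw [cnLaw, withDensity_apply _ MeasurableSet.univ, Measure.restrict_univ,
    ← ofReal_integral_eq_lintegral_ofReal (integrable_cnPDF m hv)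
      (Eventually.of_forall fun z => (cnPDF_pos m hv z).le), integral_cnPDF m hv]
  simp

/-- Completing the square bounds the weighted density by a constant times the normal density of
variance `2 * v`. These exponential moments supply both the polynomial moments and the domination
needed to differentiate under the integral. -/
theorem integrable_exp_norm_cnLaw (m : ℂ) {v : ℝ} (hv : 0 < v) (c : ℝ) :
    Integrable (fun z => Real.exp (c * ‖z - m‖)) (cnLaw m v) := by
  rw [integrable_cnLaw_iff hv]
  have h := (integrable_cnPDF m (v := 2 * v) (by positivity)).const_mul
    (2 * Real.exp (c ^ 2 * v / 2))
  refine h.mono' ?_ (Eventually.of_forall fun z => ?_)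
  · exact ((continuous_cnPDF m v).mul (by fun_prop)).aestronglyMeasurable
  · have h0 := cnPDF_pos m hv z
    rw [Real.norm_of_nonneg (by positivity)]
    unfold cnPDF
    have e : 2 * Real.exp (c ^ 2 * v / 2) *
        ((Real.pi * (2 * v))⁻¹ * Real.exp (-(‖z - m‖ ^ 2 / (2 * v)))) =
        (Real.pi * v)⁻¹ * Real.exp (c ^ 2 * v / 2 + -(‖z - m‖ ^ 2 / (2 * v))) := by
      rw [Real.exp_add]; field_simp
    rw [e, mul_assoc, ← Real.exp_add]
    refine mul_le_mul_of_nonneg_left (Real.exp_le_exp.2 ?_) (by positivity)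
    have key : c ^ 2 * v / 2 + -(‖z - m‖ ^ 2 / (2 * v)) - (-(‖z - m‖ ^ 2 / v) + c * ‖z - m‖) =
        (c * v - ‖z - m‖) ^ 2 / (2 * v) := by
      field_simp; ring
    have : 0 ≤ (c * v - ‖z - m‖) ^ 2 / (2 * v) := by positivity
    linarith

theorem integral_cnLaw_sub (m : ℂ) {v : ℝ} (hv : 0 < v) (f : ℂ → ℝ) :
    ∫ z, f (z - m) ∂(cnLaw m v) = ∫ z, f z ∂(cnLaw 0 v) := by
  rw [integral_cnLaw hv, integral_cnLaw hv,
    ← integral_sub_right_eq_self (fun z => cnPDF 0 v z * f z) m]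
  simp [cnPDF]

/-- Circular symmetry: the centred density depends only on the norm and Lebesgue measure is
preserved. It replaces coordinate computations of first and second moments. -/
theorem integral_cnLaw_comp_isometry {v : ℝ} (hv : 0 < v) (L : ℂ ≃ₗᵢ[ℝ] ℂ) (f : ℂ → ℝ) :
    ∫ z, f (L z) ∂(cnLaw 0 v) = ∫ z, f z ∂(cnLaw 0 v) := by
  rw [integral_cnLaw hv, integral_cnLaw hv,
    ← L.measurePreserving.integral_comp L.toHomeomorph.measurableEmbedding
      fun z => cnPDF 0 v z * f z]
  simp [cnPDF]

theorem integral_norm_sq_cnLaw {v : ℝ} (hv : 0 < v) : ∫ z, ‖z‖ ^ 2 ∂(cnLaw 0 v) = v := by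
  have h := Complex.integral_rpow_mul_exp_neg_mul_rpow (p := 2) (q := 2) (b := v⁻¹)
    (by norm_num) (by norm_num) (inv_pos.2 hv)
  norm_num at h
  rw [integral_cnLaw hv]
  have e : ∀ z : ℂ, cnPDF 0 v z * ‖z‖ ^ 2 =
      (Real.pi * v)⁻¹ * (‖z‖ ^ 2 * Real.exp (-(v⁻¹ * ‖z‖ ^ 2))) := by
    intro z
    simp only [cnPDF, sub_zero]
    rw [show ‖z‖ ^ 2 / v = v⁻¹ * ‖z‖ ^ 2 by ring]; ring
  simp_rw [e]
  rw [integral_const_mul, h]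
  field_simp

theorem integrable_pow_norm_cnLaw (m : ℂ) {v : ℝ} (hv : 0 < v) (k : ℕ) :
    Integrable (fun z => ‖z - m‖ ^ k) (cnLaw m v) := by
  refine ((integrable_exp_norm_cnLaw m hv 1).const_mul (k.factorial : ℝ)).mono'
    (by fun_prop) (Eventually.of_forall fun z => ?_)
  rw [Real.norm_of_nonneg (by positivity), one_mul]
  have := Real.pow_div_factorial_le_exp (‖z - m‖) (norm_nonneg _) k
  rw [div_le_iff₀ (by positivity)] at this
  linarith

theorem memLp_norm_cnLaw (m : ℂ) {v : ℝ} (hv : 0 < v) :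
    MemLp (fun z => z - m) 2 (cnLaw m v) := by
  rw [memLp_two_iff_integrable_sq_norm (by fun_prop)]
  exact integrable_pow_norm_cnLaw m hv 2

theorem integral_re_conj_mul_cnLaw (m : ℂ) {v : ℝ} (hv : 0 < v) (a : ℂ) :
    ∫ z, (conj (z - m) * a).re ∂(cnLaw m v) = 0 := by
  rw [integral_cnLaw_sub m hv fun z => (conj z * a).re]
  -- The integrand is odd, so the integral equals its own negative.
  have h := integral_cnLaw_comp_isometry hv (LinearIsometryEquiv.neg ℝ) fun z => (conj z * a).re
  simp only [LinearIsometryEquiv.coe_neg, map_neg, neg_mul, Complex.neg_re,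
    integral_neg] at h
  linarith

theorem memLp_re_conj_mul_cnLaw (m : ℂ) {v : ℝ} (hv : 0 < v) (a : ℂ) :
    MemLp (fun z => (conj (z - m) * a).re) 2 (cnLaw m v) := by
  refine ((memLp_norm_cnLaw m hv).norm.const_mul ‖a‖).mono (by fun_prop)
    (Eventually.of_forall fun z => ?_)
  refine (Complex.abs_re_le_norm _).trans ?_
  rw [norm_mul, RCLike.norm_conj, norm_mul, norm_norm, norm_norm, mul_comm]

/-- Rotating `z` by `I` exchanges real and imaginary parts up to sign. The integrand and its rotated
copy have the same integral and add up pointwise to `‖z‖ ^ 2 * (conj a * b).re`, whence half of the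
variance. -/
theorem integral_re_mul_re_cnLaw (m : ℂ) {v : ℝ} (hv : 0 < v) (a b : ℂ) :
    ∫ z, (conj (z - m) * a).re * (conj (z - m) * b).re ∂(cnLaw m v) =
      v / 2 * (conj a * b).re := by
  rw [integral_cnLaw_sub m hv fun z => (conj z * a).re * (conj z * b).re]
  have h := integral_cnLaw_comp_isometry hv
    (rotation ⟨Complex.I, by simp [Submonoid.unitSphere]⟩)
    fun z => (conj z * a).re * (conj z * b).re
  have i1 : ∀ a b : ℂ, Integrable (fun z => (conj z * a).re * (conj z * b).re) (cnLaw 0 v) := by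
    intro a b
    have := (memLp_re_conj_mul_cnLaw 0 hv a).integrable_mul (memLp_re_conj_mul_cnLaw 0 hv b)
    simpa only [sub_zero, Pi.mul_def] using this
  have e : ∀ z : ℂ, (conj z * a).re * (conj z * b).re + (conj (Complex.I * z) * a).re *
      (conj (Complex.I * z) * b).re = ‖z‖ ^ 2 * (conj a * b).re := by
    intro z
    rw [← Complex.normSq_eq_norm_sq, Complex.normSq_apply]
    simp
    ring
  have h2 : ∫ z, ((conj z * a).re * (conj z * b).re + (conj (Complex.I * z) * a).re *
      (conj (Complex.I * z) * b).re) ∂(cnLaw 0 v) = v * (conj a * b).re := by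
    simp_rw [e]
    rw [integral_mul_const, integral_norm_sq_cnLaw hv]
  rw [integral_add (i1 a b)] at h2
  · have h' : ∫ z, (conj (Complex.I * z) * a).re * (conj (Complex.I * z) * b).re ∂(cnLaw 0 v) =
        ∫ z, (conj z * a).re * (conj z * b).re ∂(cnLaw 0 v) := h
    rw [h'] at h2
    linarith
  · have := i1 (-Complex.I * a) (-Complex.I * b)
    refine this.congr (Eventually.of_forall fun z => ?_)
    simp only [map_mul, Complex.conj_I]
    ring_nf

/-! ## The law of the observation -/

section Observation

variable {I P : Type*} [Fintype I]

theorem obsPDF_pos (m : I → ℂ) {v : I → ℝ} (hv : ∀ i, 0 < v i) (y : I → ℂ) :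
    0 < obsPDF m v y :=
  Finset.prod_pos fun i _ => cnPDF_pos _ (hv i) _

theorem continuous_obsPDF (m : I → ℂ) (v : I → ℝ) : Continuous (obsPDF m v) :=
  continuous_finsetProd _ fun i _ => (continuous_cnPDF _ _).comp (continuous_apply i)

theorem integral_obsLaw {m : I → ℂ} {v : I → ℝ} (hv : ∀ i, 0 < v i) (f : (I → ℂ) → ℝ) :
    ∫ y, f y ∂(obsLaw m v) = ∫ y, obsPDF m v y * f y := by
  unfold obsLaw
  rw [integral_withDensity_eq_integral_toReal_smul
    (continuous_obsPDF m v).measurable.ennreal_ofReal (by simp)]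
  simp [ENNReal.toReal_ofReal (obsPDF_pos m hv _).le]

/-- On a box, the joint density times the indicator is a product of functions of one entry each, so
its integral factorises. This form of the law is what gives marginals and independence. -/
theorem obsLaw_eq_pi (m : I → ℂ) {v : I → ℝ} (hv : ∀ i, 0 < v i) :
    obsLaw m v = Measure.pi fun i => cnLaw (m i) (v i) := by
  have := fun i => isProbabilityMeasure_cnLaw (m i) (hv i)
  symm
  refine Measure.pi_eq fun s hs => ?_
  have hm := MeasurableSet.univ_pi hs
  have hi : ∀ i, Integrable ((s i).indicator (cnPDF (m i) (v i))) := fun i =>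
    (integrable_cnPDF _ (hv i)).indicator (hs i)
  have hnn : ∀ i z, 0 ≤ (s i).indicator (cnPDF (m i) (v i)) z := fun i z =>
    Set.indicator_nonneg (fun z _ => (cnPDF_pos _ (hv i) z).le) z
  have e : ∀ y : I → ℂ, (Set.univ.pi s).indicator (fun y => ENNReal.ofReal (obsPDF m v y)) y =
      ENNReal.ofReal (∏ i, (s i).indicator (cnPDF (m i) (v i)) (y i)) := by
    intro y
    by_cases hy : y ∈ Set.univ.pi s
    · rw [Set.indicator_of_mem hy, obsPDF]
      congr 1
      exact Finset.prod_congr rfl fun i _ => (Set.indicator_of_mem (hy i trivial) _).symm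
    · rw [Set.indicator_of_notMem hy]
      obtain ⟨i, hi⟩ : ∃ i, y i ∉ s i := by simpa using hy
      rw [Finset.prod_eq_zero (Finset.mem_univ i) (Set.indicator_of_notMem hi _),
        ENNReal.ofReal_zero]
  rw [obsLaw, withDensity_apply _ hm, ← lintegral_indicator hm]
  simp_rw [e]
  rw [← ofReal_integral_eq_lintegral_ofReal,
    integral_fintype_prod_volume_eq_prod fun i => (s i).indicator (cnPDF (m i) (v i)),
    ENNReal.ofReal_prod_of_nonneg fun i _ => integral_nonneg (hnn i)]
  · refine Finset.prod_congr rfl fun i _ => ?_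
    rw [cnLaw, withDensity_apply _ (hs i), ← lintegral_indicator (hs i),
      ofReal_integral_eq_lintegral_ofReal (hi i) (Eventually.of_forall (hnn i))]
    refine lintegral_congr fun z => ?_
    by_cases hz : z ∈ s i <;> simp [hz]
  · exact Integrable.fintype_prod hi
  · exact Eventually.of_forall fun y => Finset.prod_nonneg fun i _ => hnn i _

theorem isProbabilityMeasure_obsLaw (m : I → ℂ) {v : I → ℝ} (hv : ∀ i, 0 < v i) :
    IsProbabilityMeasure (obsLaw m v) := by
  have := fun i => isProbabilityMeasure_cnLaw (m i) (hv i)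
  rw [obsLaw_eq_pi m hv]
  infer_instance

theorem measurePreserving_eval_obsLaw (m : I → ℂ) {v : I → ℝ} (hv : ∀ i, 0 < v i) (i : I) :
    MeasurePreserving (Function.eval i) (obsLaw m v) (cnLaw (m i) (v i)) := by
  have := fun i => isProbabilityMeasure_cnLaw (m i) (hv i)
  rw [obsLaw_eq_pi m hv]
  exact measurePreserving_eval _ i

theorem integral_eval_obsLaw (m : I → ℂ) {v : I → ℝ} (hv : ∀ i, 0 < v i) (i : I)
    {f : ℂ → ℝ} (hf : Continuous f) :
    ∫ y, f (y i) ∂(obsLaw m v) = ∫ z, f z ∂(cnLaw (m i) (v i)) := by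
  have h := measurePreserving_eval_obsLaw m hv i
  rw [← h.map_eq, integral_map h.measurable.aemeasurable (by fun_prop)]

theorem memLp_re_conj_mul_obsLaw (m : I → ℂ) {v : I → ℝ} (hv : ∀ i, 0 < v i) (i : I) (a : ℂ) :
    MemLp (fun y => (conj (y i - m i) * a).re) 2 (obsLaw m v) :=
  (memLp_re_conj_mul_cnLaw (m i) (hv i) a).comp_measurePreserving
    (measurePreserving_eval_obsLaw m hv i)

theorem integral_re_conj_mul_obsLaw (m : I → ℂ) {v : I → ℝ} (hv : ∀ i, 0 < v i) (i : I) (a : ℂ) :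
    ∫ y, (conj (y i - m i) * a).re ∂(obsLaw m v) = 0 := by
  rw [integral_eval_obsLaw m hv i (f := fun z => (conj (z - m i) * a).re) (by fun_prop),
    integral_re_conj_mul_cnLaw _ (hv i)]

theorem integral_re_mul_re_obsLaw [DecidableEq I] (m : I → ℂ) {v : I → ℝ} (hv : ∀ i, 0 < v i)
    (i j : I) (a b : ℂ) :
    ∫ y, (conj (y i - m i) * a).re * (conj (y j - m j) * b).re ∂(obsLaw m v) =
      if i = j then v i / 2 * (conj a * b).re else 0 := by
  split_ifs with hij
  · subst hij
    rw [integral_eval_obsLaw m hv i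
      (f := fun z => (conj (z - m i) * a).re * (conj (z - m i) * b).re) (by fun_prop),
      integral_re_mul_re_cnLaw _ (hv i)]
  · have := fun i => isProbabilityMeasure_cnLaw (m i) (hv i)
    have hind := (ProbabilityTheory.iIndepFun_pi (μ := fun i => cnLaw (m i) (v i))
      (X := fun _ => id) (fun _ => aemeasurable_id)).indepFun hij
    have h2 := hind.integral_fun_comp_mul_comp (f := fun z => (conj (z - m i) * a).re)
      (g := fun z => (conj (z - m j) * b).re) (measurable_pi_apply i).aemeasurable
      (measurable_pi_apply j).aemeasurable (by fun_prop) (by fun_prop)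
    rw [← obsLaw_eq_pi m hv] at h2
    simp only [id] at h2
    rw [h2, integral_re_conj_mul_obsLaw m hv i, zero_mul]

theorem integrable_exp_sum_norm_obsLaw (m : I → ℂ) {v : I → ℝ} (hv : ∀ i, 0 < v i) (c : I → ℝ) :
    Integrable (fun y => Real.exp (∑ i, c i * ‖y i - m i‖)) (obsLaw m v) := by
  have := fun i => isProbabilityMeasure_cnLaw (m i) (hv i)
  rw [obsLaw_eq_pi m hv]
  simp_rw [Real.exp_sum]
  exact Integrable.fintype_prod fun i => integrable_exp_norm_cnLaw (m i) (hv i) (c i)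

end Observation

/-! ## Fisher information and the Cramér-Rao bound of a differentiable mean -/

theorem integrable_fun_mul_of_memLp_two {α : Type*} {_ : MeasurableSpace α} {μ : Measure α}
    {f g : α → ℝ} (hf : MemLp f 2 μ) (hg : MemLp g 2 μ) : Integrable (fun x => f x * g x) μ :=
  hf.integrable_mul hg

section CramerRao

variable {I P : Type*} [Fintype I]

/-- The score of the Gaussian model whose mean has partial derivatives `D`. -/
def gaussScore (m : I → ℂ) (v : I → ℝ) (D : P → I → ℂ) (y : I → ℂ) (p : P) : ℝ :=
  ∑ i, (conj (y i - m i) * ((2 / v i : ℝ) * D p i)).re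

theorem memLp_gaussScore (m : I → ℂ) {v : I → ℝ} (hv : ∀ i, 0 < v i) (D : P → I → ℂ) (p : P) :
    MemLp (fun y => gaussScore m v D y p) 2 (obsLaw m v) :=
  memLp_finsetSum _ fun i _ => memLp_re_conj_mul_obsLaw m hv i _

theorem integral_gaussScore (m : I → ℂ) {v : I → ℝ} (hv : ∀ i, 0 < v i) (D : P → I → ℂ) (p : P) :
    ∫ y, gaussScore m v D y p ∂(obsLaw m v) = 0 := by
  have := isProbabilityMeasure_obsLaw m hv
  unfold gaussScore
  rw [integral_finsetSum _ fun i _ =>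
    (memLp_re_conj_mul_obsLaw m hv i _).integrable (by norm_num)]
  exact Finset.sum_eq_zero fun i _ => integral_re_conj_mul_obsLaw m hv i _

theorem integral_gaussScore_mul (m : I → ℂ) {v : I → ℝ} (hv : ∀ i, 0 < v i) (D : P → I → ℂ)
    (p q : P) :
    ∫ y, gaussScore m v D y p * gaussScore m v D y q ∂(obsLaw m v) =
      ∑ i, 2 / v i * (conj (D p i) * D q i).re := by
  classical
  have hint : ∀ i j, Integrable (fun y => (conj (y i - m i) * ((2 / v i : ℝ) * D p i)).re *
      (conj (y j - m j) * ((2 / v j : ℝ) * D q j)).re) (obsLaw m v) := fun i j =>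
    (memLp_re_conj_mul_obsLaw m hv i _).integrable_mul (memLp_re_conj_mul_obsLaw m hv j _)
  simp_rw [gaussScore, Finset.sum_mul_sum]
  rw [integral_finsetSum _ fun i _ => integrable_finsetSum _ fun j _ => hint i j]
  refine Finset.sum_congr rfl fun i _ => ?_
  rw [integral_finsetSum _ fun j _ => hint i j]
  simp_rw [integral_re_mul_re_obsLaw m hv]
  -- Only equal samples survive, each with weight `(2 / v) ^ 2 * (v / 2) = 2 / v`.
  rw [Finset.sum_ite_eq Finset.univ i, if_pos (Finset.mem_univ i)]
  have hvi := (hv i).ne'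
  rw [map_mul, Complex.conj_ofReal, mul_mul_mul_comm, ← Complex.ofReal_mul, Complex.re_ofReal_mul]
  field_simp

theorem log_obsPDF (m : I → ℂ) {v : I → ℝ} (hv : ∀ i, 0 < v i) (y : I → ℂ) :
    Real.log (obsPDF m v y) =
      ∑ i, (Real.log (Real.pi * v i)⁻¹ + -(‖y i - m i‖ ^ 2 / v i)) := by
  unfold obsPDF
  rw [Real.log_prod fun i _ => (cnPDF_pos _ (hv i) _).ne']
  refine Finset.sum_congr rfl fun i _ => ?_
  have := hv i
  rw [cnPDF, Real.log_mul (by positivity) (Real.exp_pos _).ne', Real.log_exp]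

theorem hasDerivAt_norm_sub_sq {f : ℝ → ℂ} {f' : ℂ} {t : ℝ} (hf : HasDerivAt f f' t) (z : ℂ) :
    HasDerivAt (fun s => ‖z - f s‖ ^ 2) (-2 * (conj (z - f t) * f').re) t := by
  have h := (hf.const_sub z).norm_sq
  refine h.congr_deriv ?_
  rw [Complex.inner]
  simp
  ring

/-- `D` are the partial derivatives at `ρ` of the mean `m` of the observation. -/
def HasPartials [DecidableEq P] (m : (P → ℝ) → I → ℂ) (ρ : P → ℝ) (D : P → I → ℂ) : Prop :=
  ∀ p i, HasDerivAt (fun s => m (Function.update ρ p s) i) (D p i) (ρ p)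

variable [DecidableEq P] {m : (P → ℝ) → I → ℂ} {v : I → ℝ} {ρ : P → ℝ} {D : P → I → ℂ}

theorem score_eq_gaussScore (hv : ∀ i, 0 < v i) (hD : HasPartials m ρ D) (y : I → ℂ) (p : P) :
    score m v ρ y p = gaussScore (m ρ) v D y p := by
  unfold score gaussScore
  simp_rw [log_obsPDF _ hv]
  refine HasDerivAt.deriv (HasDerivAt.fun_sum fun i _ => ?_)
  have h := (((hasDerivAt_norm_sub_sq (hD p i) (y i)).div_const (v i)).neg).const_add
    (Real.log (Real.pi * v i)⁻¹)
  refine h.congr_deriv ?_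
  rw [Function.update_eq_self, mul_left_comm, Complex.re_ofReal_mul]
  ring

theorem fisher_eq_sum (hv : ∀ i, 0 < v i) (hD : HasPartials m ρ D) :
    fisher m v ρ = Matrix.of fun p q => ∑ i, 2 / v i * (conj (D p i) * D q i).re := by
  ext p q
  simp only [fisher, Matrix.of_apply, score_eq_gaussScore hv hD]
  exact integral_gaussScore_mul _ hv _ _ _

/-! ### Likelihood ratios, differentiation under the integral sign, and the information inequality
-/

/-- The log-likelihood ratio of the means `m + δ` and `m`. -/
def logRatio (m δ : I → ℂ) (v : I → ℝ) (y : I → ℂ) : ℝ :=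
  ∑ i, (2 * (conj (y i - m i) * δ i).re - ‖δ i‖ ^ 2) / v i

theorem obsPDF_eq_mul_exp (m m' : I → ℂ) (v : I → ℝ) (y : I → ℂ) :
    obsPDF m' v y = obsPDF m v y * Real.exp (logRatio m (m' - m) v y) := by
  unfold obsPDF logRatio
  rw [Real.exp_sum, ← Finset.prod_mul_distrib]
  refine Finset.prod_congr rfl fun i _ => ?_
  simp only [cnPDF]
  rw [mul_assoc, ← Real.exp_add]
  congr 2
  rw [← neg_div, ← neg_div, ← add_div]
  congr 1
  simp only [← Complex.normSq_eq_norm_sq, Complex.normSq_apply]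
  simp
  ring

/-- The restriction `|t| ≤ 1` lets the quadratic term be absorbed into a multiple of `|t|`. What
remains grows only linearly in the noise norms, so its exponential is integrable. -/
theorem abs_logRatio_le (m δ : I → ℂ) (hv : ∀ i, 0 < v i) {C t : ℝ} (ht : |t| ≤ 1)
    (hδ : ∀ i, ‖δ i‖ ≤ C * |t|) (y : I → ℂ) :
    |logRatio m δ v y| ≤ |t| * ∑ i, (2 * C / v i * ‖y i - m i‖ + C ^ 2 / v i) := by
  unfold logRatio
  refine (Finset.abs_sum_le_sum_abs _ _).trans ?_
  rw [Finset.mul_sum]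
  refine Finset.sum_le_sum fun i _ => ?_
  have hvi := hv i
  have h1 : |(conj (y i - m i) * δ i).re| ≤ ‖y i - m i‖ * (C * |t|) := by
    refine (Complex.abs_re_le_norm _).trans ?_
    rw [norm_mul, RCLike.norm_conj]
    gcongr
    exact hδ i
  have h2 : ‖δ i‖ ^ 2 ≤ C ^ 2 * |t| := by
    have : ‖δ i‖ ^ 2 ≤ (C * |t|) ^ 2 := by gcongr; exact hδ i
    have h3 : |t| * |t| ≤ |t| * 1 := by gcongr
    nlinarith [sq_nonneg C]
  rw [abs_div, abs_of_pos hvi, div_le_iff₀ hvi]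
  have e : |t| * (2 * C / v i * ‖y i - m i‖ + C ^ 2 / v i) * v i =
      2 * (‖y i - m i‖ * (C * |t|)) + C ^ 2 * |t| := by
    field_simp
  rw [e]
  refine (abs_sub _ _).trans ?_
  rw [abs_mul, abs_two, abs_of_nonneg (sq_nonneg ‖δ i‖)]
  linarith

theorem abs_exp_sub_one_le_mul_exp (x : ℝ) : |Real.exp x - 1| ≤ |x| * Real.exp |x| := by
  rcases le_total 0 x with hx | hx
  · rw [abs_of_nonneg hx, abs_of_nonneg (by linarith [Real.add_one_le_exp x])]
    have h := Real.add_one_le_exp (-x)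
    have h1 : Real.exp x * Real.exp (-x) = 1 := by rw [← Real.exp_add]; simp
    nlinarith [Real.exp_pos x]
  · rw [abs_of_nonpos hx, abs_of_nonpos (by linarith [Real.exp_le_one_iff.2 hx])]
    have h := Real.add_one_le_exp x
    have h1 : 1 ≤ Real.exp (-x) := Real.one_le_exp (by linarith)
    nlinarith

theorem memLp_exp_sum_norm_obsLaw (m : I → ℂ) (hv : ∀ i, 0 < v i) (a b : I → ℝ) :
    MemLp (fun y => Real.exp (∑ i, (a i * ‖y i - m i‖ + b i))) 2 (obsLaw m v) := by
  have hc : Continuous fun y : I → ℂ => Real.exp (∑ i, (a i * ‖y i - m i‖ + b i)) := by fun_prop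
  rw [memLp_two_iff_integrable_sq hc.aestronglyMeasurable]
  refine ((integrable_exp_sum_norm_obsLaw m hv fun i => 2 * a i).const_mul
    (Real.exp (2 * ∑ i, b i))).congr (Eventually.of_forall fun y => ?_)
  simp only [← Real.exp_add, ← Real.exp_nat_mul, Finset.sum_add_distrib, Finset.mul_sum,
    mul_add, mul_assoc, Nat.cast_ofNat]
  rw [add_comm]

/-- The term `‖δ‖ ^ 2` has zero derivative at `δ = 0`, so only the linear term contributes. The
index type `Unit` views the curve as a one-parameter model. -/
theorem hasDerivAt_logRatio {μ : ℝ → I → ℂ} {D : I → ℂ} {t₀ : ℝ}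
    (hμ : ∀ i, HasDerivAt (fun s => μ s i) (D i) t₀) (y : I → ℂ) :
    HasDerivAt (fun s => logRatio (μ t₀) (μ s - μ t₀) v y)
      (gaussScore (μ t₀) v (fun _ : Unit => D) y ()) t₀ := by
  unfold logRatio gaussScore
  refine HasDerivAt.fun_sum fun i _ => ?_
  have h0 := (hμ i).sub_const (μ t₀ i)
  have h1 := Complex.reCLM.hasFDerivAt.comp_hasDerivAt t₀ (h0.const_mul (conj (y i - μ t₀ i)))
  have h2 := ((h1.const_mul 2).sub h0.norm_sq).div_const (v i)
  refine h2.congr_deriv ?_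
  rw [mul_left_comm, Complex.re_ofReal_mul]
  simp
  ring

/-- Differentiation of the mean of a square integrable statistic under the integral sign. -/
theorem hasDerivAt_integral_obsLaw (hv : ∀ i, 0 < v i) {μ : ℝ → I → ℂ} {D : I → ℂ} {t₀ : ℝ}
    (hμ : ∀ i, HasDerivAt (fun s => μ s i) (D i) t₀) {f : (I → ℂ) → ℝ}
    (hf : MemLp f 2 (obsLaw (μ t₀) v)) :
    HasDerivAt (fun s => ∫ y, f y ∂(obsLaw (μ s) v))
      (∫ y, f y * gaussScore (μ t₀) v (fun _ : Unit => D) y () ∂(obsLaw (μ t₀) v)) t₀ := by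
  have hprob := isProbabilityMeasure_obsLaw (μ t₀) hv
  set R : ℝ → (I → ℂ) → ℝ := fun s y => Real.exp (logRatio (μ t₀) (μ s - μ t₀) v y) with hR
  have hRc : ∀ s, Continuous (R s) := fun s => by
    simp only [hR, logRatio]; fun_prop
  have hF : ∀ s, ∫ y, f y ∂(obsLaw (μ s) v) = ∫ y, f y * R s y ∂(obsLaw (μ t₀) v) := fun s => by
    rw [integral_obsLaw hv, integral_obsLaw hv]
    refine integral_congr_ae (Eventually.of_forall fun y => ?_)
    simp only [hR, obsPDF_eq_mul_exp (μ t₀) (μ s)]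
    ring
  -- Differentiability at the single point `t₀` already gives a linear bound on the increments
  -- nearby. Dominating difference quotients rather than derivatives means that nothing is needed at
  -- other points.
  choose c hc using fun i => (hμ i).isBigO_sub.bound
  set C : ℝ := ∑ i, |c i|
  have hδ : ∀ᶠ s in 𝓝 t₀, ∀ i, ‖(μ s - μ t₀) i‖ ≤ C * |s - t₀| := by
    refine (eventually_all.2 hc).mono fun s hs i => (hs i).trans ?_
    rw [Real.norm_eq_abs]
    gcongr
    exact (le_abs_self _).trans
      (Finset.single_le_sum (f := fun i => |c i|) (fun _ _ => abs_nonneg _) (Finset.mem_univ i))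
  set K : (I → ℂ) → ℝ := fun y => ∑ i, (2 * C / v i * ‖y i - μ t₀ i‖ + C ^ 2 / v i) with hK
  -- From `|exp x - 1| ≤ |x| * exp |x|` with `|x| ≤ |s - t₀| * K y ≤ K y`; the second exponential
  -- absorbs the factor `K y ≤ exp (K y)`.
  have hbound : ∀ᶠ s in 𝓝 t₀, ∀ y, |R s y - 1| ≤ |s - t₀| * Real.exp (2 * K y) := by
    have h1 : ∀ᶠ s in 𝓝 t₀, |s - t₀| ≤ 1 := by
      have : Tendsto (fun s => |s - t₀|) (𝓝 t₀) (𝓝 0) := by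
        have h : Continuous fun s : ℝ => |s - t₀| := by fun_prop
        simpa using h.tendsto t₀
      exact (this.eventually (gt_mem_nhds one_pos)).mono fun s hs => hs.le
    filter_upwards [hδ, h1] with s hs hs1 y
    have h2 := abs_logRatio_le (μ t₀) _ hv hs1 hs y
    have h3 : |logRatio (μ t₀) (μ s - μ t₀) v y| ≤ |s - t₀| * K y := h2
    have hK0 : 0 ≤ K y := by
      refine Finset.sum_nonneg fun i _ => ?_
      have := hv i
      positivity
    refine (abs_exp_sub_one_le_mul_exp _).trans ?_
    have h4 : |s - t₀| * K y ≤ K y := mul_le_of_le_one_left hK0 hs1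
    calc _ ≤ |s - t₀| * K y * Real.exp (K y) := by
          gcongr
          exact h3.trans h4
      _ ≤ |s - t₀| * Real.exp (K y) * Real.exp (K y) := by
          gcongr
          linarith [Real.add_one_le_exp (K y)]
      _ = _ := by rw [mul_assoc, ← Real.exp_add, two_mul]
  -- Square integrability of `f` is used here: both factors lie in `L²`.
  have hdom : Integrable (fun y => ‖f y‖ * Real.exp (2 * K y)) (obsLaw (μ t₀) v) := by
    have h := memLp_exp_sum_norm_obsLaw (μ t₀) hv (fun i => 2 * (2 * C / v i))
      fun i => 2 * (C ^ 2 / v i)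
    refine (hf.norm.integrable_mul h).congr (Eventually.of_forall fun y => ?_)
    simp only [Pi.mul_apply, hK, Finset.mul_sum, mul_add, mul_assoc]
  have hfi : Integrable f (obsLaw (μ t₀) v) := hf.integrable (by norm_num)
  rw [hasDerivAt_iff_tendsto_slope]
  have hslope : ∀ᶠ s in 𝓝[≠] t₀, ∫ y, f y * ((s - t₀)⁻¹ * (R s y - 1)) ∂(obsLaw (μ t₀) v) =
      slope (fun s => ∫ y, f y ∂(obsLaw (μ s) v)) t₀ s := by
    filter_upwards [hbound.filter_mono nhdsWithin_le_nhds] with s hs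
    have hi : Integrable (fun y => f y * (R s y - 1)) (obsLaw (μ t₀) v) := by
      refine (hdom.const_mul |s - t₀|).mono' (hf.1.mul ?_) (Eventually.of_forall fun y => ?_)
      · exact ((hRc s).sub continuous_const).aestronglyMeasurable
      · rw [norm_mul, Real.norm_eq_abs (R s y - 1), mul_left_comm]
        exact mul_le_mul_of_nonneg_left (hs y) (norm_nonneg _)
    have e : ∀ y, f y * R s y = f y * (R s y - 1) + f y := fun y => by ring
    simp_rw [slope_def_field, hF s, e]
    rw [integral_add hi hfi, add_sub_cancel_right, div_eq_inv_mul, ← integral_const_mul]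
    exact integral_congr_ae (Eventually.of_forall fun y => by ring)
  refine Tendsto.congr' hslope ?_
  refine tendsto_integral_filter_of_dominated_convergence _ ?_ ?_ hdom ?_
  · refine Eventually.of_forall fun s => hf.1.mul ?_
    exact (continuous_const.mul ((hRc s).sub continuous_const)).aestronglyMeasurable
  · filter_upwards [hbound.filter_mono nhdsWithin_le_nhds, self_mem_nhdsWithin] with s hs hne
    refine Eventually.of_forall fun y => ?_
    have hpos : 0 < |s - t₀| := abs_pos.2 (sub_ne_zero.2 hne)
    rw [norm_mul, norm_mul, norm_inv, Real.norm_eq_abs (s - t₀), Real.norm_eq_abs (R s y - 1)]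
    gcongr
    rw [inv_mul_le_iff₀ hpos]
    exact hs y
  · refine Eventually.of_forall fun y => Tendsto.const_mul _ ?_
    have h := (hasDerivAt_logRatio (v := v) hμ y).exp
    rw [hasDerivAt_iff_tendsto_slope] at h
    have h0 : logRatio (μ t₀) 0 v y = 0 := by simp [logRatio]
    simp only [sub_self, h0, Real.exp_zero, one_mul] at h
    refine h.congr fun s => ?_
    rw [slope_def_field, sub_self, h0, Real.exp_zero, div_eq_inv_mul]

/-- The derivative of the mean of the estimator is its covariance with the score, and local
unbiasedness prescribes that derivative. Subtracting `ρ p` changes nothing because the score is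
centred. -/
theorem integral_sub_mul_gaussScore (hv : ∀ i, 0 < v i) (hD : HasPartials m ρ D)
    {est : (I → ℂ) → P → ℝ} (hest : LocallyUnbiased m v ρ est) {p : P} (q : P)
    (hp : MemLp (fun y => est y p) 2 (obsLaw (m ρ) v)) :
    ∫ y, (est y p - ρ p) * gaussScore (m ρ) v D y q ∂(obsLaw (m ρ) v) =
      if p = q then 1 else 0 := by
  have hprob := isProbabilityMeasure_obsLaw (m ρ) hv
  have h := hasDerivAt_integral_obsLaw (v := v) (t₀ := ρ q)
    (μ := fun s => m (Function.update ρ q s)) hv (hD q) (f := fun y => est y p)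
    (by simpa using hp)
  rw [Function.update_eq_self] at h
  have h2 : ∫ y, est y p * gaussScore (m ρ) v D y q ∂(obsLaw (m ρ) v) = if p = q then 1 else 0 :=
    h.unique (hest.deriv_eq p q)
  have hs := memLp_gaussScore (m ρ) hv D q
  simp_rw [sub_mul]
  rw [integral_sub (integrable_fun_mul_of_memLp_two hp hs) ((hs.integrable (by norm_num)).const_mul _),
    integral_const_mul, integral_gaussScore _ hv, h2]
  simp

/-- One diagonal entry of the Cramér-Rao bound, for a row `a` of the inverse information matrix. -/
theorem le_integral_sq_of_row [Fintype P] (hv : ∀ i, 0 < v i) (hD : HasPartials m ρ D)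
    {est : (I → ℂ) → P → ℝ} (hest : LocallyUnbiased m v ρ est) {p : P}
    (hp : MemLp (fun y => est y p - ρ p) 2 (obsLaw (m ρ) v)) (a : P → ℝ)
    (ha : ∀ q', ∑ q, a q * fisher m v ρ q q' = if p = q' then 1 else 0) :
    a p ≤ ∫ y, (est y p - ρ p) ^ 2 ∂(obsLaw (m ρ) v) := by
  have hprob := isProbabilityMeasure_obsLaw (m ρ) hv
  set L := obsLaw (m ρ) v
  set Z : (I → ℂ) → P → ℝ := gaussScore (m ρ) v D with hZ
  have hest2 : MemLp (fun y => est y p) 2 L :=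
    (memLp_congr_ae (Eventually.of_forall fun y => sub_add_cancel (est y p) (ρ p))).1
      (hp.add (memLp_const (ρ p)))
  have hZ2 : ∀ q, MemLp (fun y => Z y q) 2 L := memLp_gaussScore (m ρ) hv D
  have haZ : MemLp (fun y => ∑ q, a q * Z y q) 2 L :=
    memLp_finsetSum _ fun q _ => (hZ2 q).const_mul _
  have hfish : ∀ p q, ∫ y, Z y p * Z y q ∂L = fisher m v ρ p q := fun p q => by
    simp only [hZ, fisher, Matrix.of_apply, score_eq_gaussScore hv hD]
    rfl
  have cross : ∫ y, (est y p - ρ p) * ∑ q, a q * Z y q ∂L = a p := by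
    simp_rw [Finset.mul_sum, mul_left_comm _ (a _)]
    rw [integral_finsetSum _ fun q _ =>
      (integrable_fun_mul_of_memLp_two hp (hZ2 q)).const_mul _]
    have : ∀ q, ∫ y, (est y p - ρ p) * Z y q ∂L = if p = q then 1 else 0 := fun q =>
      integral_sub_mul_gaussScore hv hD hest q hest2
    simp [integral_const_mul, this]
  have square : ∫ y, (∑ q, a q * Z y q) * ∑ q, a q * Z y q ∂L = a p := by
    have hi : ∀ q q', Integrable (fun y => a q * a q' * (Z y q * Z y q')) L := fun q q' =>
      (integrable_fun_mul_of_memLp_two (hZ2 q) (hZ2 q')).const_mul _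
    simp_rw [Finset.sum_mul_sum, mul_mul_mul_comm]
    rw [integral_finsetSum _ fun q _ => integrable_finsetSum _ fun q' _ => hi q q']
    simp_rw [fun q => integral_finsetSum Finset.univ fun q' _ => hi q q', integral_const_mul,
      hfish]
    rw [Finset.sum_comm]
    have : ∀ q', ∑ q, a q * a q' * fisher m v ρ q q' = a q' * (if p = q' then 1 else 0) := by
      intro q'
      rw [← ha, Finset.mul_sum]
      exact Finset.sum_congr rfl fun q _ => by ring
    simp [this]
  -- The cross moment and the second moment of the score combination both equal `a p`, so expanding
  -- gives `0 ≤ E err² - 2 * a p + a p`.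
  have hnn : 0 ≤ ∫ y, ((est y p - ρ p) - ∑ q, a q * Z y q) ^ 2 ∂L :=
    integral_nonneg fun y => sq_nonneg _
  have e : ∀ y, ((est y p - ρ p) - ∑ q, a q * Z y q) ^ 2 =
      ((est y p - ρ p) ^ 2 - 2 * ((est y p - ρ p) * ∑ q, a q * Z y q)) +
        (∑ q, a q * Z y q) * ∑ q, a q * Z y q := fun y => by ring
  have hi1 : Integrable (fun y => (est y p - ρ p) ^ 2) L :=
    (memLp_two_iff_integrable_sq hp.1).1 hp
  have hi2 : Integrable (fun y => 2 * ((est y p - ρ p) * ∑ q, a q * Z y q)) L :=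
    (integrable_fun_mul_of_memLp_two hp haZ).const_mul 2
  have hi3 := integrable_fun_mul_of_memLp_two haZ haZ
  have hi12 : Integrable (fun y => (est y p - ρ p) ^ 2 -
    2 * ((est y p - ρ p) * ∑ q, a q * Z y q)) L := hi1.sub hi2
  simp_rw [e] at hnn
  rw [integral_add hi12 hi3, integral_sub hi1 hi2, integral_const_mul, cross, square] at hnn
  linarith

/-- The Cramér-Rao bound. -/
theorem trace_inv_fisher_le_mse [Fintype P] (hv : ∀ i, 0 < v i) (hD : HasPartials m ρ D)
    (hJ : IsUnit (fisher m v ρ)) {est : (I → ℂ) → P → ℝ} (hest : LocallyUnbiased m v ρ est) :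
    ENNReal.ofReal ((fisher m v ρ)⁻¹.trace) ≤ mse m v ρ est := by
  -- An infinite error makes the bound trivial; a finite one makes every error coordinate square
  -- integrable, as differentiation under the integral requires.
  by_cases hfin : mse m v ρ est = ⊤
  · simp [hfin]
  set L := obsLaw (m ρ) v
  have hmeas : ∀ p, Measurable fun y => est y p := fun p =>
    (measurable_pi_apply p).comp hest.measurable
  have hsum : Integrable (fun y => ∑ p, (est y p - ρ p) ^ 2) L := by
    refine ⟨by fun_prop, ?_⟩
    rw [hasFiniteIntegral_iff_ofReal
      (Eventually.of_forall fun y => Finset.sum_nonneg fun p _ => sq_nonneg _)]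
    exact lt_top_iff_ne_top.2 hfin
  have hi : ∀ p, Integrable (fun y => (est y p - ρ p) ^ 2) L := fun p => by
    refine hsum.mono' (by fun_prop) (Eventually.of_forall fun y => ?_)
    rw [Real.norm_of_nonneg (sq_nonneg _)]
    exact Finset.single_le_sum (f := fun p => (est y p - ρ p) ^ 2) (fun _ _ => sq_nonneg _)
      (Finset.mem_univ p)
  have hE : ∀ p, MemLp (fun y => est y p - ρ p) 2 L := fun p => by
    rw [memLp_two_iff_integrable_sq (by fun_prop)]
    exact hi p
  have hinv := Matrix.nonsing_inv_mul _ ((Matrix.isUnit_iff_isUnit_det _).1 hJ)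
  unfold mse
  rw [← ofReal_integral_eq_lintegral_ofReal hsum
    (Eventually.of_forall fun y => Finset.sum_nonneg fun p _ => sq_nonneg _)]
  refine ENNReal.ofReal_le_ofReal ?_
  rw [integral_finsetSum _ fun p _ => hi p, Matrix.trace]
  refine Finset.sum_le_sum fun p _ => le_integral_sq_of_row hv hD hest (hE p) ((fisher m v ρ)⁻¹ p) fun q' => ?_
  rw [← Matrix.one_apply, ← hinv, Matrix.mul_apply]

end CramerRao

/-! ## Averaging an inverse information matrix -/

section Averaging

variable {Ω P : Type*} {_ : MeasurableSpace Ω} [Fintype P]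

/-- Passing to the positive part of `f` handles its sign. No integrability or measurability of `g`
is asked for, since `g` will be a form or trace of an inverse matrix whose mean may be infinite. -/
theorem ofReal_integral_le_lintegral {μ : Measure Ω} {f g : Ω → ℝ} (hf : Integrable f μ)
    (hfg : ∀ᵐ ω ∂μ, f ω ≤ g ω) :
    ENNReal.ofReal (∫ ω, f ω ∂μ) ≤ ∫⁻ ω, ENNReal.ofReal (g ω) ∂μ := by
  have h1 : ∫ ω, f ω ∂μ ≤ ∫ ω, max (f ω) 0 ∂μ :=
    integral_mono hf hf.pos_part fun ω => le_max_left _ _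
  refine (ENNReal.ofReal_le_ofReal h1).trans ?_
  rw [ofReal_integral_eq_lintegral_ofReal hf.pos_part
    (Eventually.of_forall fun ω => le_max_right _ _)]
  refine lintegral_mono_ae (hfg.mono fun ω hω => ?_)
  rw [ENNReal.ofReal_max, ENNReal.ofReal_zero, max_eq_left zero_le]
  exact ENNReal.ofReal_le_ofReal hω

/-- The concave minorants whose supremum is the quadratic form of the inverse matrix. -/
theorem two_mul_dotProduct_sub_le_inv [DecidableEq P] {J : Matrix P P ℝ} (hJ : J.PosDef) (x z : P → ℝ) :
    2 * (x ⬝ᵥ z) - x ⬝ᵥ (J *ᵥ x) ≤ z ⬝ᵥ (J⁻¹ *ᵥ z) := by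
  have hu := (Matrix.isUnit_iff_isUnit_det _).1 hJ.isUnit
  -- The gap between the two sides is the form of `J` at `x - J⁻¹ z`, so equality holds at `x = J⁻¹
  -- z`.
  have h := hJ.posSemidef.dotProduct_mulVec_nonneg (x - J⁻¹ *ᵥ z)
  have hs : Jᵀ = J := (Matrix.isHermitian_iff_isSymm.1 hJ.isHermitian).eq
  have h1 : J *ᵥ (J⁻¹ *ᵥ z) = z := by
    rw [Matrix.mulVec_mulVec, Matrix.mul_nonsing_inv _ hu, Matrix.one_mulVec]
  have h2 : (J⁻¹ *ᵥ z) ⬝ᵥ (J *ᵥ x) = z ⬝ᵥ x := by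
    rw [Matrix.dotProduct_mulVec, ← Matrix.mulVec_transpose, hs, h1]
  rw [star_trivial, Matrix.mulVec_sub, h1, sub_dotProduct, dotProduct_sub, dotProduct_sub, h2,
    dotProduct_comm (J⁻¹ *ᵥ z) z, dotProduct_comm z x] at h
  linarith

variable {μ : Measure Ω} {J : Ω → Matrix P P ℝ} {A : Matrix P P ℝ}
theorem integrable_dotProduct_mulVec (hint : ∀ p q, Integrable (fun ω => J ω p q) μ)
    (x : P → ℝ) : Integrable (fun ω => x ⬝ᵥ (J ω *ᵥ x)) μ := by
  unfold Matrix.mulVec dotProduct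
  exact integrable_finsetSum _ fun p _ => (integrable_finsetSum _ fun q _ =>
    (hint p q).mul_const _).const_mul _

theorem integral_dotProduct_mulVec (hint : ∀ p q, Integrable (fun ω => J ω p q) μ)
    (hA : ∀ p q, ∫ ω, J ω p q ∂μ = A p q) (x : P → ℝ) :
    ∫ ω, x ⬝ᵥ (J ω *ᵥ x) ∂μ = x ⬝ᵥ (A *ᵥ x) := by
  unfold Matrix.mulVec dotProduct
  have h2 : ∀ p, Integrable (fun ω => ∑ q, J ω p q * x q) μ := fun p =>
    integrable_finsetSum _ fun q _ => (hint p q).mul_const _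
  rw [integral_finsetSum _ fun p _ => (h2 p).const_mul _]
  refine Finset.sum_congr rfl fun p _ => ?_
  rw [integral_const_mul, integral_finsetSum _ fun q _ => (hint p q).mul_const _]
  simp_rw [integral_mul_const, hA]

/-- Strictness survives integration: a nonnegative form with zero integral vanishes almost
everywhere, which contradicts almost sure positivity because the measure is nonzero. -/
theorem posDef_of_ae_posDef [NeZero μ] (hint : ∀ p q, Integrable (fun ω => J ω p q) μ)
    (hA : ∀ p q, ∫ ω, J ω p q ∂μ = A p q) (hpos : ∀ᵐ ω ∂μ, (J ω).PosDef) : A.PosDef := by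
  refine Matrix.PosDef.of_dotProduct_mulVec_pos ?_ fun x hx => ?_
  · ext p q
    rw [Matrix.conjTranspose_apply, star_trivial, ← hA, ← hA]
    exact integral_congr_ae (hpos.mono fun ω h => by simpa using h.isHermitian.apply p q)
  · rw [star_trivial, ← integral_dotProduct_mulVec hint hA]
    have h1 : ∀ᵐ ω ∂μ, 0 < x ⬝ᵥ (J ω *ᵥ x) := hpos.mono fun ω h => by
      simpa using h.dotProduct_mulVec_pos hx
    refine lt_of_le_of_ne (integral_nonneg_of_ae (h1.mono fun ω h => h.le)) fun h0 => ?_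
    have h2 := (integral_eq_zero_iff_of_nonneg_ae (h1.mono fun ω h => h.le)
      (integrable_dotProduct_mulVec hint x)).1 h0.symm
    obtain ⟨ω, hω1, hω2⟩ := (h1.and h2).exists
    exact hω1.ne' hω2

/-- The Jensen inequality for the matrix inverse. -/
theorem ofReal_inv_le_lintegral_inv [DecidableEq P] [IsProbabilityMeasure μ]
    (hint : ∀ p q, Integrable (fun ω => J ω p q) μ)
    (hA : ∀ p q, ∫ ω, J ω p q ∂μ = A p q) (hpos : ∀ᵐ ω ∂μ, (J ω).PosDef)
    (z : P → ℝ) :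
    ENNReal.ofReal (z ⬝ᵥ (A⁻¹ *ᵥ z)) ≤ ∫⁻ ω, ENNReal.ofReal (z ⬝ᵥ ((J ω)⁻¹ *ᵥ z)) ∂μ := by
  have hAp := posDef_of_ae_posDef hint hA hpos
  have hu := (Matrix.isUnit_iff_isUnit_det _).1 hAp.isUnit
  -- The maximiser for the averaged matrix; with this fixed `x` the integrated minorant is exactly
  -- the form of `A⁻¹` at `z`.
  set x := A⁻¹ *ᵥ z
  have hx : A *ᵥ x = z := by
    rw [Matrix.mulVec_mulVec, Matrix.mul_nonsing_inv _ hu, Matrix.one_mulVec]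
  have hi := integrable_dotProduct_mulVec hint x
  have h := ofReal_integral_le_lintegral ((integrable_const (2 * (x ⬝ᵥ z))).sub hi)
    (hpos.mono fun ω h => two_mul_dotProduct_sub_le_inv h x z)
  simp only [Pi.sub_apply] at h
  rw [integral_sub (integrable_const _) hi, integral_dotProduct_mulVec hint hA, hx] at h
  convert h using 2
  rw [integral_const, probReal_univ, one_smul, dotProduct_comm z x]
  ring

/-- The optimal minorants for all basis vectors are summed before integrating, so the integral of
the inverse trace never has to be split. -/
theorem ofReal_trace_inv_le_lintegral [DecidableEq P] [IsProbabilityMeasure μ]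
    (hint : ∀ p q, Integrable (fun ω => J ω p q) μ)
    (hA : ∀ p q, ∫ ω, J ω p q ∂μ = A p q) (hpos : ∀ᵐ ω ∂μ, (J ω).PosDef) :
    ENNReal.ofReal A⁻¹.trace ≤ ∫⁻ ω, ENNReal.ofReal (J ω)⁻¹.trace ∂μ := by
  have hAp := posDef_of_ae_posDef hint hA hpos
  have hu := (Matrix.isUnit_iff_isUnit_det _).1 hAp.isUnit
  set x : P → P → ℝ := fun p => A⁻¹ *ᵥ Pi.single p 1
  have hx : ∀ p, A *ᵥ x p = Pi.single p 1 := fun p => by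
    rw [Matrix.mulVec_mulVec, Matrix.mul_nonsing_inv _ hu, Matrix.one_mulVec]
  have htr : ∀ B : Matrix P P ℝ, B.trace = ∑ p, Pi.single p 1 ⬝ᵥ (B *ᵥ Pi.single p 1) := fun B =>
    by simp [Matrix.trace]
  have hi := fun p => integrable_dotProduct_mulVec hint (x p)
  have hi2 : ∀ p, Integrable (fun ω => 2 * (x p ⬝ᵥ Pi.single p 1) - x p ⬝ᵥ (J ω *ᵥ x p)) μ :=
    fun p => (integrable_const _).sub (hi p)
  have h := ofReal_integral_le_lintegral (integrable_finsetSum Finset.univ fun p _ => hi2 p)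
    (hpos.mono fun ω h => (Finset.sum_le_sum fun p _ =>
      two_mul_dotProduct_sub_le_inv h (x p) (Pi.single p 1)).trans_eq (htr _).symm)
  rw [integral_finsetSum _ fun p _ => hi2 p] at h
  convert h using 2
  rw [htr]
  refine Finset.sum_congr rfl fun p _ => ?_
  rw [integral_sub (integrable_const _) (hi p), integral_dotProduct_mulVec hint hA, hx,
    integral_const, probReal_univ, one_smul, dotProduct_comm]
  ring

end Averaging

/-! ## Linear Gaussian models with unknown gains -/

section LinearModel

variable {I ι Q : Type*} [Fintype I] [Fintype Q]

/-- Partial derivatives of the mean `Γ(κ') h` in the coordinates `(κ', Re h, Im h)`. -/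
def linPartials (Γ : Matrix I Q ℂ) (Ξ : I → Matrix ι Q ℂ) (h : Q → ℂ) :
    ι ⊕ (Q ⊕ Q) → I → ℂ :=
  Sum.elim (fun k i => ∑ q, conj (Ξ i k q) * h q)
    (Sum.elim (fun q i => Γ i q) fun q i => Complex.I * Γ i q)

/-- Each sample contributes a real Gram matrix: `Ξ h*` is the conjugate of the location derivatives,
and the derivatives `γ` and `I * γ` in the two real parts of a gain produce the real and imaginary
blocks. -/
theorem explicitFIM_eq_sum (v : I → ℝ) (Γ : Matrix I Q ℂ) (Ξ : I → Matrix ι Q ℂ) (h : Q → ℂ) :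
    explicitFIM v Γ Ξ h = Matrix.of fun p q =>
      ∑ i, 2 / v i * (conj (linPartials Γ Ξ h p i) * linPartials Γ Ξ h q i).re := by
  have hx : ∀ i k, (Ξ i *ᵥ star h) k = conj (∑ q, conj (Ξ i k q) * h q) := fun i k => by
    simp [Matrix.mulVec, dotProduct, map_sum]
  have hx2 : ∀ i k l, (Ξ i * Matrix.vecMulVec (star h) h * (Ξ i)ᴴ) k l =
      conj (∑ q, conj (Ξ i k q) * h q) * ∑ q, conj (Ξ i l q) * h q := fun i k l => by
    rw [Matrix.mul_vecMulVec, Matrix.vecMulVec_mul, Matrix.vecMulVec_apply, hx]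
    congr 1
    simp [Matrix.vecMul, dotProduct, mul_comm]
  obtain ⟨d, hd⟩ : ∃ d : I → ι → ℂ, ∀ i k, ∑ q, conj (Ξ i k q) * h q = d i k :=
    ⟨_, fun _ _ => rfl⟩
  simp only [hd] at hx hx2
  ext (k | p | p) (l | q | q) <;>
    simp only [explicitFIM, Matrix.sum_apply, Matrix.smul_apply, smul_eq_mul, Matrix.of_apply,
      linPartials, Sum.elim_inl, Sum.elim_inr, hd] <;>
    refine Finset.sum_congr rfl fun i _ => congrArg _ ?_
  · simp only [Matrix.fromBlocks_apply₁₁, Matrix.map_apply, hx2]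
  · simp [realRow, Matrix.vecMulVec_apply, hx]
  · simp [realRow, Matrix.vecMulVec_apply, hx]
    ring
  · simp [realRow, Matrix.vecMulVec_apply, hx]
    ring
  · simp [realify, Matrix.vecMulVec_apply]
  · simp [realify, Matrix.vecMulVec_apply]
    ring
  · simp [realRow, Matrix.vecMulVec_apply, hx]
    ring
  · simp [realify, Matrix.vecMulVec_apply]
    ring
  · simp [realify, Matrix.vecMulVec_apply]

/-- Since `Re (conj a * b) = a.re * b.re + a.im * b.im`, every sample gives a positive multiple of a
sum of two real rank-one squares. -/
theorem posSemidef_explicitFIM [Fintype ι] {v : I → ℝ} (hv : ∀ i, 0 < v i) (Γ : Matrix I Q ℂ)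
    (Ξ : I → Matrix ι Q ℂ) (h : Q → ℂ) : (explicitFIM v Γ Ξ h).PosSemidef := by
  rw [explicitFIM_eq_sum]
  generalize linPartials Γ Ξ h = D
  have e : (Matrix.of fun p q => ∑ i, 2 / v i * (conj (D p i) * D q i).re) =
      ∑ i, (2 / v i) • (Matrix.vecMulVec (fun p => (D p i).re) (star fun p => (D p i).re) +
        Matrix.vecMulVec (fun p => (D p i).im) (star fun p => (D p i).im)) := by
    ext p q
    simp [Matrix.sum_apply, Matrix.vecMulVec_apply, mul_add]
  rw [e]
  refine Matrix.posSemidef_sum _ fun i _ => Matrix.PosSemidef.smul ?_ (div_pos two_pos (hv i)).le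
  exact (Matrix.posSemidef_vecMulVec_self_star _).add (Matrix.posSemidef_vecMulVec_self_star _)

variable [DecidableEq ι] [DecidableEq Q]

theorem fisher_eq_explicitFIM {v : I → ℝ} (hv : ∀ i, 0 < v i) {Γ : Matrix I Q ℂ}
    {Ξ : I → Matrix ι Q ℂ} {m : (ι ⊕ (Q ⊕ Q) → ℝ) → I → ℂ} {κ' : ι → ℝ} {h : Q → ℂ}
    (hD : HasPartials m (pack κ' h) (linPartials Γ Ξ h)) :
    fisher m v (pack κ' h) = explicitFIM v Γ Ξ h := by
  rw [fisher_eq_sum hv hD, explicitFIM_eq_sum]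

end LinearModel

section RandomGains

variable {I ι Q : Type*} [Fintype I] {ν : Measure (Q → ℂ)} {τsq : Q → ℝ}

theorem memLp_gain (hτ : ∀ p, 0 < τsq p) (hν : ∀ p, ν.map (fun h => h p) = cnLaw 0 (τsq p))
    (p : Q) : MemLp (fun h : Q → ℂ => h p) 2 ν := by
  have h := memLp_norm_cnLaw 0 (hτ p)
  simp only [sub_zero] at h
  exact h.comp_measurePreserving ⟨measurable_pi_apply p, hν p⟩

theorem integral_re_conj_gain_mul (hτ : ∀ p, 0 < τsq p)
    (hν : ∀ p, ν.map (fun h => h p) = cnLaw 0 (τsq p)) (p : Q) (a : ℂ) :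
    ∫ h, (conj (h p) * a).re ∂ν = 0 := by
  have h := integral_re_conj_mul_cnLaw 0 (hτ p) a
  rw [← hν p, integral_map (measurable_pi_apply p).aemeasurable (by fun_prop)] at h
  simpa only [sub_zero] using h

/-- Square integrability depends only on the marginals, so this holds under any joint law of the
gains. -/
theorem integrable_conj_gain_mul_gain (hτ : ∀ p, 0 < τsq p)
    (hν : ∀ p, ν.map (fun h => h p) = cnLaw 0 (τsq p)) (p q : Q) :
    Integrable (fun h => conj (h p) * h q) ν :=
  (memLp_gain hτ hν p).star.integrable_mul (memLp_gain hτ hν q)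

/-- The information matrix of a linear model, averaged over centred gains. -/
theorem integrable_and_integral_explicitFIM [Fintype Q] [IsProbabilityMeasure ν] (hτ : ∀ p, 0 < τsq p)
    (hν : ∀ p, ν.map (fun h => h p) = cnLaw 0 (τsq p)) (v : I → ℝ) (Γ : Matrix I Q ℂ)
    (Ξ : I → Matrix ι Q ℂ) (p q : ι ⊕ (Q ⊕ Q)) :
    Integrable (fun h => explicitFIM v Γ Ξ h p q) ν ∧
      ∫ h, explicitFIM v Γ Ξ h p q ∂ν = averagedFIM v Γ Ξ (secondMoment ν) p q := by
  -- it suffices to treat every sample separately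
  have reduce : ∀ F : I → (Q → ℂ) → ℝ, ∀ G : I → ℝ,
      (∀ i, Integrable (F i) ν ∧ ∫ h, F i h ∂ν = G i) →
      Integrable (fun h => ∑ i, 2 / v i * F i h) ν ∧
        ∫ h, ∑ i, 2 / v i * F i h ∂ν = ∑ i, 2 / v i * G i := fun F G hFG => by
    have hi := fun i => (hFG i).1.const_mul (2 / v i)
    refine ⟨integrable_finsetSum _ fun i _ => hi i, ?_⟩
    rw [integral_finsetSum _ fun i _ => hi i]
    exact Finset.sum_congr rfl fun i _ => by rw [integral_const_mul, (hFG i).2]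
  have cross : ∀ a : Q → ℂ, Integrable (fun h : Q → ℂ => (∑ q, conj (h q) * a q).re) ν ∧
      ∫ h : Q → ℂ, (∑ q, conj (h q) * a q).re ∂ν = 0 := fun a => by
    have hi : ∀ q, Integrable (fun h : Q → ℂ => (conj (h q) * a q).re) ν := fun q =>
      (((memLp_gain hτ hν q).star.integrable (by norm_num)).mul_const (a q)).re
    simp_rw [Complex.re_sum]
    refine ⟨integrable_finsetSum _ fun q _ => hi q, ?_⟩
    rw [integral_finsetSum _ fun q _ => hi q]
    exact Finset.sum_eq_zero fun q _ => integral_re_conj_gain_mul hτ hν q _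
  have quad : ∀ a b : Q → ℂ,
      Integrable (fun h : Q → ℂ => (∑ q, ∑ q', a q * (conj (h q) * h q') * b q').re) ν ∧
      ∫ h : Q → ℂ, (∑ q, ∑ q', a q * (conj (h q) * h q') * b q').re ∂ν =
        (∑ q, ∑ q', a q * secondMoment ν q q' * b q').re := fun a b => by
    have hi : ∀ q q', Integrable (fun h : Q → ℂ => a q * (conj (h q) * h q') * b q') ν :=
      fun q q' => ((integrable_conj_gain_mul_gain hτ hν q q').const_mul _).mul_const _
    have hs : Integrable (fun h : Q → ℂ => ∑ q, ∑ q', a q * (conj (h q) * h q') * b q') ν :=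
      integrable_finsetSum _ fun q _ => integrable_finsetSum _ fun q' _ => hi q q'
    refine ⟨hs.re, ?_⟩
    refine (integral_re hs).trans (congrArg Complex.re ?_)
    rw [integral_finsetSum _ fun q _ => integrable_finsetSum _ fun q' _ => hi q q']
    refine Finset.sum_congr rfl fun q _ => ?_
    rw [integral_finsetSum _ fun q' _ => hi q q']
    refine Finset.sum_congr rfl fun q' _ => ?_
    rw [integral_mul_const, integral_const_mul]
    rfl
  have const : ∀ c : ℝ, Integrable (fun _ : Q → ℂ => c) ν ∧ ∫ _ : Q → ℂ, c ∂ν = c := fun c =>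
    ⟨integrable_const _, by simp⟩
  have hx : ∀ (h : Q → ℂ) i k, (Ξ i *ᵥ star h) k = ∑ q, conj (h q) * Ξ i k q := fun h i k => by
    simp [Matrix.mulVec, dotProduct, mul_comm]
  have sandwich : ∀ (A : Matrix Q Q ℂ) i k l, (Ξ i * A * (Ξ i)ᴴ) k l =
      ∑ q, ∑ q', Ξ i k q * A q q' * conj (Ξ i l q') := fun A i k l => by
    simp only [Matrix.mul_apply, Finset.sum_mul, Matrix.conjTranspose_apply]
    exact Finset.sum_comm
  have row : ∀ i k q, ∃ a : Q → ℂ, ∀ h : Q → ℂ,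
      realRow (Matrix.vecMulVec (Ξ i *ᵥ star h) (Γ i)) k q = (∑ q', conj (h q') * a q').re := by
    rintro i k (q | q)
    · refine ⟨fun q' => Ξ i k q' * Γ i q, fun h => ?_⟩
      simp only [realRow, Matrix.fromCols_apply_inl, Matrix.map_apply, Matrix.vecMulVec_apply, hx,
        Finset.sum_mul, mul_assoc]
    -- The columns for `Im h` carry `-Im`, and `-Im z = Re (I * z)` brings them to the form treated
    -- by `cross`.
    · refine ⟨fun q' => Complex.I * (Ξ i k q' * Γ i q), fun h => ?_⟩
      simp only [realRow, Matrix.fromCols_apply_inr, Matrix.neg_apply, Matrix.map_apply,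
        Matrix.vecMulVec_apply, hx, Finset.sum_mul, ← Complex.I_mul_re, Finset.mul_sum]
      congr 1
      exact Finset.sum_congr rfl fun q' _ => by ring
  rcases p with k | p <;> rcases q with l | q <;>
    simp only [explicitFIM, averagedFIM, Matrix.sum_apply, Matrix.smul_apply, smul_eq_mul,
      Matrix.fromBlocks_apply₁₁, Matrix.fromBlocks_apply₁₂, Matrix.fromBlocks_apply₂₁,
      Matrix.fromBlocks_apply₂₂] <;>
    refine reduce _ _ fun i => ?_
  · simp only [Matrix.map_apply, sandwich, Matrix.vecMulVec_apply, Pi.star_apply]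
    exact quad _ _
  · obtain ⟨a, ha⟩ := row i k q
    simp only [ha, Matrix.zero_apply]
    exact cross a
  · obtain ⟨a, ha⟩ := row i l p
    simp only [Matrix.transpose_apply, ha, Matrix.zero_apply]
    exact cross a
  · exact const _

/-- Fisher information, Cramér-Rao bound and its average over the gains in a linear model. -/
theorem linear_model_information_bounds [Fintype Q] [Fintype ι] [DecidableEq ι] [DecidableEq Q]
    {v : I → ℝ} (hv : ∀ i, 0 < v i) {Γ : Matrix I Q ℂ}
    {Ξ : I → Matrix ι Q ℂ} {m : (ι ⊕ (Q ⊕ Q) → ℝ) → I → ℂ} {κ' : ι → ℝ}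
    (hD : ∀ h : Q → ℂ, HasPartials m (pack κ' h) (linPartials Γ Ξ h)) :
    (∀ h : Q → ℂ, fisher m v (pack κ' h) = explicitFIM v Γ Ξ h ∧
      (IsUnit (fisher m v (pack κ' h)) → ∀ est, LocallyUnbiased m v (pack κ' h) est →
        ENNReal.ofReal (fisher m v (pack κ' h))⁻¹.trace ≤ mse m v (pack κ' h) est)) ∧
    (∀ (ν : Measure (Q → ℂ)) [IsProbabilityMeasure ν] (τsq : Q → ℝ),
      (∀ p, 0 < τsq p) → (∀ p, ν.map (fun h => h p) = cnLaw 0 (τsq p)) →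
      (∀ p q, Integrable (fun h => fisher m v (pack κ' h) p q) ν ∧
        ∫ h, fisher m v (pack κ' h) p q ∂ν = averagedFIM v Γ Ξ (secondMoment ν) p q) ∧
      ((∀ᵐ h ∂ν, IsUnit (fisher m v (pack κ' h))) →
        IsUnit (averagedFIM v Γ Ξ (secondMoment ν)) ∧
        (∀ z, ENNReal.ofReal (z ⬝ᵥ ((averagedFIM v Γ Ξ (secondMoment ν))⁻¹ *ᵥ z)) ≤
          ∫⁻ h, ENNReal.ofReal (z ⬝ᵥ ((fisher m v (pack κ' h))⁻¹ *ᵥ z)) ∂ν) ∧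
        ENNReal.ofReal (averagedFIM v Γ Ξ (secondMoment ν))⁻¹.trace ≤
          ∫⁻ h, ENNReal.ofReal (fisher m v (pack κ' h))⁻¹.trace ∂ν ∧
        (∀ est : (Q → ℂ) → (I → ℂ) → ι ⊕ (Q ⊕ Q) → ℝ,
          (∀ᵐ h ∂ν, LocallyUnbiased m v (pack κ' h) (est h)) →
          ∫⁻ h, ENNReal.ofReal (fisher m v (pack κ' h))⁻¹.trace ∂ν ≤
            ∫⁻ h, mse m v (pack κ' h) (est h) ∂ν))) := by
  have hJ : ∀ h : Q → ℂ, fisher m v (pack κ' h) = explicitFIM v Γ Ξ h := fun h =>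
    fisher_eq_explicitFIM hv (hD h)
  refine ⟨fun h => ⟨hJ h, fun hu est hest => trace_inv_fisher_le_mse hv (hD h) hu hest⟩,
    fun ν _ τsq hτ hν => ?_⟩
  have hE : ∀ p q, Integrable (fun h => fisher m v (pack κ' h) p q) ν ∧
      ∫ h, fisher m v (pack κ' h) p q ∂ν = averagedFIM v Γ Ξ (secondMoment ν) p q := by
    simp_rw [hJ]
    exact integrable_and_integral_explicitFIM hτ hν v Γ Ξ
  refine ⟨hE, fun hu => ?_⟩
  have hint := fun p q => (hE p q).1
  have hA := fun p q => (hE p q).2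
  -- An information matrix is always positive semidefinite, so invertibility upgrades it to positive
  -- definite.
  have hpos : ∀ᵐ h ∂ν, (fisher m v (pack κ' h)).PosDef := hu.mono fun h hh =>
    (hJ h ▸ posSemidef_explicitFIM hv Γ Ξ h : (fisher m v (pack κ' h)).PosSemidef).posDef_iff_isUnit.2 hh
  refine ⟨(posDef_of_ae_posDef hint hA hpos).isUnit,
    ofReal_inv_le_lintegral_inv hint hA hpos, ofReal_trace_inv_le_lintegral hint hA hpos,
    fun est hest => lintegral_mono_ae ?_⟩
  filter_upwards [hu, hest] with h hh hesth
  exact trace_inv_fisher_le_mse hv (hD h) hh hesth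

end RandomGains

/-! ## Derivatives of the geometry -/

section GeometryDerivatives

variable {N L₁ L₂ : ℕ} {S : RISSystem N} {κ : Coord N L₁ L₂ → ℝ} (k : Coord N L₁ L₂)

theorem hasDerivAt_update_apply {α : Type*} [DecidableEq α] (x : α → ℝ) (k c : α) (t : ℝ) :
    HasDerivAt (fun s => Function.update x k s c) (if c = k then 1 else 0) t := by
  by_cases h : c = k
  · subst h
    simpa using hasDerivAt_id' t
  · simpa [h] using hasDerivAt_const t (x c)

theorem hasDerivAt_pos (P : Pt N L₁ L₂) (i : Fin 2) (t : ℝ) :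
    HasDerivAt (fun s => P.pos S (Function.update κ k s) i)
      (if P.coord i = some k then 1 else 0) t := by
  cases P with
  | bs n => simpa [Pt.pos, Pt.coord] using hasDerivAt_const t (S.bs n i)
  | _ => simpa [Pt.pos, Pt.coord] using hasDerivAt_update_apply κ k _ t

theorem hasDerivAt_disp (P Q : Pt N L₁ L₂) (i : Fin 2) (t : ℝ) :
    HasDerivAt (fun s => disp S (Function.update κ k s) P Q i) (dDisp k P Q i) t :=
  (hasDerivAt_pos k P i t).sub (hasDerivAt_pos k Q i t)

variable {k}

theorem norm_disp_pos {P Q : Pt N L₁ L₂} (h : disp S κ P Q 1 ≠ 0) : 0 < ‖disp S κ P Q‖ :=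
  norm_pos_iff.2 fun h0 => h (by simp [h0])

theorem hasDerivAt_len {P Q : Pt N L₁ L₂} (h : disp S κ P Q 1 ≠ 0) :
    HasDerivAt (fun s => len S (Function.update κ k s) P Q) (dLen S κ k P Q) (κ k) := by
  have hpos := norm_disp_pos h
  simp only [len, EuclideanSpace.norm_eq, Real.norm_eq_abs, sq_abs]
  have h1 : HasDerivAt (fun s => ∑ i, disp S (Function.update κ k s) P Q i ^ 2)
      (∑ i, 2 * disp S κ P Q i * dDisp k P Q i) (κ k) := by
    refine HasDerivAt.fun_sum fun i _ => ?_
    refine ((hasDerivAt_disp k P Q i (κ k)).pow 2).congr_deriv ?_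
    simp
  have hn : ∑ i, disp S κ P Q i ^ 2 = ‖disp S κ P Q‖ ^ 2 := by
    simp [EuclideanSpace.norm_sq_eq]
  refine (h1.sqrt ?_).congr_deriv ?_
  · rw [Function.update_eq_self, hn]
    positivity
  · rw [Function.update_eq_self, hn, Real.sqrt_sq hpos.le, dLen, Finset.sum_div]
    refine Finset.sum_congr rfl fun i _ => ?_
    field_simp

theorem hasDerivAt_ang {P Q : Pt N L₁ L₂} (h : disp S κ P Q 1 ≠ 0) :
    HasDerivAt (fun s => ang S (Function.update κ k s) P Q) (dAng S κ k P Q) (κ k) := by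
  have hpos := norm_disp_pos h
  -- A nonzero second coordinate keeps the cosine away from `±1`, where the arccosine is not
  -- differentiable.
  have hsq : (disp S κ P Q 0 / ‖disp S κ P Q‖) ^ 2 < 1 := by
    rw [div_pow, div_lt_one (by positivity), EuclideanSpace.norm_sq_eq, Fin.sum_univ_two]
    simp only [Real.norm_eq_abs, sq_abs]
    have : 0 < disp S κ P Q 1 ^ 2 := by positivity
    linarith
  have hq : HasDerivAt (fun s => disp S (Function.update κ k s) P Q 0 /
      ‖disp S (Function.update κ k s) P Q‖) ((dDisp k P Q 0 * ‖disp S κ P Q‖ -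
        disp S κ P Q 0 * dLen S κ k P Q) / ‖disp S κ P Q‖ ^ 2) (κ k) := by
    have := (hasDerivAt_disp (S := S) (κ := κ) k P Q 0 (κ k)).div (hasDerivAt_len h)
      (by rw [Function.update_eq_self]; exact hpos.ne')
    simp only [Function.update_eq_self] at this
    exact this
  have h2 := Real.hasDerivAt_arccos (x := disp S κ P Q 0 / ‖disp S κ P Q‖)
    (fun h => by rw [h] at hsq; norm_num at hsq) (fun h => by rw [h] at hsq; norm_num at hsq)
  rw [← Function.update_eq_self k κ] at h2
  refine (h2.comp (κ k) hq).congr_deriv ?_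
  rw [Function.update_eq_self, dAng, dLen]
  simp only [Fin.sum_univ_two, Fin.isValue, if_true, one_ne_zero, if_false]
  generalize 1 / √(1 - (disp S κ P Q 0 / ‖disp S κ P Q‖) ^ 2) = a
  field_simp
  ring

variable (k)

theorem hasDerivAt_toaG (hκ : RegularGeometry S κ) (n : Fin N) (l : Fin (L₁ + 1)) :
    HasDerivAt (fun s => toaG S (Function.update κ k s) n l) (dToaG S κ k n l) (κ k) := by
  obtain ⟨-, h1, h2, -⟩ := hκ
  cases l using Fin.cases with
  | zero => exact (hasDerivAt_len (h1 n)).div_const _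
  | succ l => exact ((hasDerivAt_len (h2 l n).1).add (hasDerivAt_len (h2 l n).2)).div_const _

theorem hasDerivAt_toaH (hκ : RegularGeometry S κ) (n : Fin N) (l : Fin (L₂ + 1)) :
    HasDerivAt (fun s => toaH S (Function.update κ k s) n l) (dToaH S κ k n l) (κ k) := by
  obtain ⟨h1, -, -, h2⟩ := hκ
  cases l using Fin.cases with
  | zero => exact (hasDerivAt_len h1).div_const _
  | succ l => exact ((hasDerivAt_len (h2 l n).1).add (hasDerivAt_len (h2 l n).2)).div_const _

theorem hasDerivAt_angT (hκ : RegularGeometry S κ) (n : Fin N) (l : Fin (L₁ + 1)) :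
    HasDerivAt (fun s => angT S (Function.update κ k s) n l) (dAngT S κ k n l) (κ k) := by
  obtain ⟨-, h1, h2, -⟩ := hκ
  cases l using Fin.cases with
  | zero => exact (hasDerivAt_ang (h1 n)).sub_const _
  | succ l => exact (hasDerivAt_ang (h2 l n).2).sub_const _

theorem hasDerivAt_rotation (c : Coord N L₁ L₂) (t : ℝ) :
    HasDerivAt (fun s => Function.update κ k s c) (if k = c then 1 else 0) t := by
  simpa only [eq_comm] using hasDerivAt_update_apply κ k c t

theorem hasDerivAt_angR (hκ : RegularGeometry S κ) (n : Fin N) (l : Fin (L₁ + 1)) :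
    HasDerivAt (fun s => angR S (Function.update κ k s) n l) (dAngR S κ k n l) (κ k) := by
  obtain ⟨-, h1, h2, -⟩ := hκ
  cases l using Fin.cases with
  | zero => exact ((hasDerivAt_ang (h1 n)).const_add _).sub (hasDerivAt_rotation k _ _)
  | succ l => exact ((hasDerivAt_ang (h2 l n).1).const_add _).sub (hasDerivAt_rotation k _ _)

theorem hasDerivAt_angU (hκ : RegularGeometry S κ) (n : Fin N) (l : Fin (L₂ + 1)) :
    HasDerivAt (fun s => angU S (Function.update κ k s) n l) (dAngU S κ k n l) (κ k) := by
  obtain ⟨h1, -, -, h2⟩ := hκ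
  cases l using Fin.cases with
  | zero => exact (hasDerivAt_ang h1).sub (hasDerivAt_rotation k _ _)
  | succ l => exact (hasDerivAt_ang (h2 l n).2).sub (hasDerivAt_rotation k _ _)

theorem hasDerivAt_angRbar (hκ : RegularGeometry S κ) (n : Fin N) (l : Fin (L₂ + 1)) :
    HasDerivAt (fun s => angRbar S (Function.update κ k s) n l) (dAngRbar S κ k n l) (κ k) := by
  obtain ⟨h1, -, -, h2⟩ := hκ
  cases l using Fin.cases with
  | zero => exact ((hasDerivAt_ang h1).const_add _).sub (hasDerivAt_rotation k _ _)
  | succ l => exact ((hasDerivAt_ang (h2 l n).1).const_add _).sub (hasDerivAt_rotation k _ _)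

end GeometryDerivatives

/-! ## Derivatives of the channels -/

section ChannelDerivatives

/-- Delay phases and steering entries all have this form, so differentiation multiplies by `-I φ'`.
Hence a path coefficient differentiates to itself times a sum of such terms, with the sign reversed
for the conjugated steering entry. -/
theorem hasDerivAt_cexp_neg_I_mul {φ : ℝ → ℝ} {φ' t : ℝ} (h : HasDerivAt φ φ' t) :
    HasDerivAt (fun s => Complex.exp (-(Complex.I * (φ s : ℂ))))
      (Complex.exp (-(Complex.I * (φ t : ℂ))) * -(Complex.I * φ')) t :=
  (h.ofReal_comp.const_mul Complex.I).neg.cexp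

theorem hasDerivAt_steer {φ : ℝ → ℝ} {φ' t : ℝ} (h : HasDerivAt φ φ' t) (d lam : ℝ) (i : ℕ) :
    HasDerivAt (fun s => steer d lam (φ s) i)
      (steer d lam (φ t) i *
        -(Complex.I * (d * Real.pi / lam * i * (Real.cos (φ t) * φ') : ℝ))) t :=
  hasDerivAt_cexp_neg_I_mul (h.sin.const_mul _)

variable {N NS M NT NR NU L₁ L₂ : ℕ} {S : RISSystem N} {κ : Coord N L₁ L₂ → ℝ}

theorem hasDerivAt_delayPhase {τ : ℝ → ℝ} {τ' t : ℝ} (h : HasDerivAt τ τ' t) (n : Fin N)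
    (s : Fin NS) :
    HasDerivAt (fun x => delayPhase S n s (τ x))
      (delayPhase S n s (τ t) *
        -(Complex.I * (2 * Real.pi * ((subcarrier n s : ℝ) / (NS * S.Ts)) * τ' : ℝ))) t :=
  hasDerivAt_cexp_neg_I_mul (h.const_mul _)

theorem hasDerivAt_coefG (hκ : RegularGeometry S κ) (k : Coord N L₁ L₂) (n : Fin N) (s : Fin NS)
    (l : Fin (L₁ + 1)) (i : Fin NR) (a : Fin NT) :
    HasDerivAt (fun x => coefG S (Function.update κ k x) n s NT NR l i a)
      (coefG S κ n s NT NR l i a * logDG S κ n s k l i a) (κ k) := by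
  have h1 := hasDerivAt_delayPhase (S := S) (hasDerivAt_toaG k hκ n l) n s
  have h2 := hasDerivAt_steer (hasDerivAt_angR k hκ n l) S.dR (waveLen S n s) i
  have h3 := (hasDerivAt_steer (hasDerivAt_angT k hκ n l) S.dT (waveLen S n s) a).star
  refine (((h1.const_mul _).mul h2).mul h3).congr_deriv ?_
  simp only [Pi.mul_apply, Function.update_eq_self, star_mul', star_neg, coefG, logDG, Complex.star_def,
    Complex.conj_I, Complex.conj_ofReal]
  push_cast
  ring

theorem hasDerivAt_coefH (hκ : RegularGeometry S κ) (k : Coord N L₁ L₂) (n : Fin N) (s : Fin NS)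
    (l : Fin (L₂ + 1)) (r : Fin NU) (i : Fin NR) :
    HasDerivAt (fun x => coefH S (Function.update κ k x) n s NR NU l r i)
      (coefH S κ n s NR NU l r i * logDH S κ n s k l r i) (κ k) := by
  have h1 := hasDerivAt_delayPhase (S := S) (hasDerivAt_toaH k hκ n l) n s
  have h2 := hasDerivAt_steer (hasDerivAt_angU k hκ n l) S.dU (waveLen S n s) r
  have h3 := (hasDerivAt_steer (hasDerivAt_angRbar k hκ n l) S.dR (waveLen S n s) i).star
  refine (((h1.const_mul _).mul h2).mul h3).congr_deriv ?_
  simp only [Pi.mul_apply, Function.update_eq_self, star_mul', star_neg, coefH, logDH, Complex.star_def,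
    Complex.conj_I, Complex.conj_ofReal]
  push_cast
  ring

theorem chanG_apply (n : Fin N) (s : Fin NS) (g : GainIdx N L₁ → ℂ) (i : Fin NR) (a : Fin NT) :
    chanG S κ n s NT NR g i a = ∑ l, g (n, l) * coefG S κ n s NT NR l i a := by
  rw [chanG, Matrix.mul_apply]
  simp only [Matrix.mul_diagonal, Matrix.conjTranspose_apply, steerR,
    steerT, Matrix.of_apply, coefG]
  exact Finset.sum_congr rfl fun l _ => by rw [Complex.star_def]; ring

theorem chanH_apply (n : Fin N) (s : Fin NS) (h : GainIdx N L₂ → ℂ) (r : Fin NU) (i : Fin NR) :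
    chanH S κ n s NR NU h r i = ∑ l, h (n, l) * coefH S κ n s NR NU l r i := by
  rw [chanH, Matrix.mul_apply]
  simp only [Matrix.mul_diagonal, Matrix.conjTranspose_apply, steerU,
    steerRbar, Matrix.of_apply, coefH]
  exact Finset.sum_congr rfl fun l _ => by rw [Complex.star_def]; ring

theorem hasDerivAt_chanG (hκ : RegularGeometry S κ) (k : Coord N L₁ L₂) (n : Fin N) (s : Fin NS)
    (g : GainIdx N L₁ → ℂ) (i : Fin NR) (a : Fin NT) :
    HasDerivAt (fun x => chanG S (Function.update κ k x) n s NT NR g i a)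
      (dChanG S κ n s NT NR g k i a) (κ k) := by
  simp only [chanG_apply]
  exact HasDerivAt.fun_sum fun l _ => (hasDerivAt_coefG hκ k n s l i a).const_mul _

theorem hasDerivAt_chanH (hκ : RegularGeometry S κ) (k : Coord N L₁ L₂) (n : Fin N) (s : Fin NS)
    (h : GainIdx N L₂ → ℂ) (r : Fin NU) (i : Fin NR) :
    HasDerivAt (fun x => chanH S (Function.update κ k x) n s NR NU h r i)
      (dChanH S κ n s NR NU h k r i) (κ k) := by
  simp only [chanH_apply]
  exact HasDerivAt.fun_sum fun l _ => (hasDerivAt_coefH hκ k n s l r i).const_mul _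

end ChannelDerivatives

/-! ## The received signal as a linear model -/

section SignalModel

variable {N NS M NT NR NU L₁ L₂ : ℕ} {S : RISSystem N} {θ : Fin NR → ℝ}
  {w : Fin N → Fin NS → Fin M → Fin NT → ℂ} {κ : Coord N L₁ L₂ → ℝ}

theorem sum_gainIdx_ite {L : ℕ} (n : Fin N) (f : Fin (L + 1) → ℂ) (h : GainIdx N L → ℂ) :
    ∑ q : GainIdx N L, (if q.1 = n then f q.2 else 0) * h q = ∑ l, f l * h (n, l) := by
  rw [Fintype.sum_prod_type, Finset.sum_eq_single n (fun b _ hb => by simp [hb]) (by simp)]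
  simp

/-- Bracketing the product as `H (Θ G w)` exposes linearity in `h`; the companion identity uses `(H
Θ) (G w)` for `g`. Keeping the two location vectors apart serves both readings of a given channel.
-/
theorem signal_eq_sum_coefH (κH κG : Coord N L₁ L₂ → ℝ) (h : GainIdx N L₂ → ℂ)
    (g : GainIdx N L₁ → ℂ) (n : Fin N) (s : Fin NS) (m : Fin M) (r : Fin NU) :
    signal S θ w κH κG h g (n, s, m, r) = ∑ l, (∑ i, coefH S κH n s NR NU l r i *
      ((risMat θ * chanG S κG n s NT NR g) *ᵥ w n s m) i) * h (n, l) := by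
  rw [signal, Matrix.mul_assoc, ← Matrix.mulVec_mulVec]
  generalize (risMat θ * chanG S κG n s NT NR g) *ᵥ w n s m = V
  simp only [Matrix.mulVec, dotProduct, chanH_apply, Finset.sum_mul]
  rw [Finset.sum_comm]
  exact Finset.sum_congr rfl fun l _ => Finset.sum_congr rfl fun i _ => by ring

theorem signal_eq_sum_coefG (κH κG : Coord N L₁ L₂ → ℝ) (h : GainIdx N L₂ → ℂ)
    (g : GainIdx N L₁ → ℂ) (n : Fin N) (s : Fin NS) (m : Fin M) (r : Fin NU) :
    signal S θ w κH κG h g (n, s, m, r) = ∑ l, (∑ i, (chanH S κH n s NR NU h * risMat θ) r i *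
      ∑ a, coefG S κG n s NT NR l i a * w n s m a) * g (n, l) := by
  rw [signal, ← Matrix.mulVec_mulVec]
  generalize chanH S κH n s NR NU h * risMat θ = V
  have hG : ∀ i, (chanG S κG n s NT NR g *ᵥ w n s m) i =
      ∑ l, (∑ a, coefG S κG n s NT NR l i a * w n s m a) * g (n, l) := fun i => by
    simp only [Matrix.mulVec, dotProduct, chanG_apply, Finset.sum_mul]
    rw [Finset.sum_comm]
    exact Finset.sum_congr rfl fun l _ => Finset.sum_congr rfl fun a _ => by ring
  simp only [Matrix.mulVec.eq_1 V, dotProduct, hG]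
  refine (Finset.sum_congr rfl fun i _ => Finset.mul_sum _ _ _).trans
    (Finset.sum_comm.trans (Finset.sum_congr rfl fun l _ => ?_))
  rw [Finset.sum_mul]
  exact Finset.sum_congr rfl fun i _ => (mul_assoc _ _ _).symm

theorem signal_eq_gammaMat_mulVec (h : GainIdx N L₂ → ℂ) (g : GainIdx N L₁ → ℂ) :
    (signal S θ w κ κ h g : Obs N NS M NU → ℂ) = gammaMat S θ w κ g *ᵥ h := by
  ext ⟨n, s, m, r⟩
  rw [signal_eq_sum_coefH]
  exact (sum_gainIdx_ite n _ h).symm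

theorem signal_eq_lambdaMat_mulVec (h : GainIdx N L₂ → ℂ) (g : GainIdx N L₁ → ℂ) :
    (signal S θ w κ κ h g : Obs N NS M NU → ℂ) = lambdaMat S θ w κ h *ᵥ g := by
  ext ⟨n, s, m, r⟩
  rw [signal_eq_sum_coefG]
  exact (sum_gainIdx_ite n _ g).symm

section Parameters

variable {ι Q : Type*} (e : ι → Coord N L₁ L₂)

theorem gainsOf_pack (κ' : ι → ℝ) (h : Q → ℂ) : gainsOf (pack κ' h) = h := rfl

theorem locOf_pack (h : Q → ℂ) : locOf κ e (pack (κ ∘ e) h) = κ := by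
  ext c
  by_cases hc : ∃ k, e k = c
  · obtain ⟨k, rfl⟩ := hc
    -- At the true values the extension is consistent even where `e` repeats a coordinate.
    exact Function.FactorsThrough.extend_apply (fun a b hab => congrArg κ hab) κ k
  · exact Function.extend_apply' _ _ _ hc

variable [DecidableEq ι] [DecidableEq Q]

theorem gainsOf_update_inl (ρ : ι ⊕ (Q ⊕ Q) → ℝ) (k : ι) (s : ℝ) :
    gainsOf (Function.update ρ (Sum.inl k) s) = gainsOf ρ := by
  ext q
  simp [gainsOf]

theorem locOf_update_inr (ρ : ι ⊕ (Q ⊕ Q) → ℝ) (q : Q ⊕ Q) (s : ℝ) :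
    locOf κ e (Function.update ρ (Sum.inr q) s) = locOf κ e ρ := by
  simp [locOf]

/-- Injectivity makes one unknown control exactly one coordinate, which reduces parameter
derivatives to the coordinate derivatives of the geometry. -/
theorem locOf_update_inl {e : ι → Coord N L₁ L₂} (he : Function.Injective e) (h : Q → ℂ) (k : ι)
    (s : ℝ) :
    locOf κ e (Function.update (pack (κ ∘ e) h) (Sum.inl k) s) = Function.update κ (e k) s := by
  ext c
  by_cases hc : ∃ k', e k' = c
  · obtain ⟨k', rfl⟩ := hc
    rw [locOf, he.extend_apply]
    by_cases hk : k' = k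
    · rw [hk]; simp
    · simp [hk, he.ne hk, pack]
  · rw [locOf, Function.extend_apply' _ _ _ hc, Function.update_of_ne]
    exact fun h => hc ⟨k, h.symm⟩

theorem hasDerivAt_gainsOf_re (κ' : ι → ℝ) (h : Q → ℂ) (p q : Q) (t : ℝ) :
    HasDerivAt (fun s => gainsOf (Function.update (pack κ' h) (Sum.inr (Sum.inl p)) s) q)
      (if q = p then 1 else 0) t := by
  have e : ∀ s, gainsOf (Function.update (pack κ' h) (Sum.inr (Sum.inl p)) s) q =
      (Function.update (fun q => (h q).re) p s q : ℝ) + (h q).im * Complex.I := fun s => by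
    apply Complex.ext <;> by_cases hq : q = p <;> simp [gainsOf, pack, hq, Function.update_apply]
  simp_rw [e]
  refine ((hasDerivAt_update_apply _ p q t).ofReal_comp.add_const _).congr_deriv ?_
  split_ifs <;> simp

theorem hasDerivAt_gainsOf_im (κ' : ι → ℝ) (h : Q → ℂ) (p q : Q) (t : ℝ) :
    HasDerivAt (fun s => gainsOf (Function.update (pack κ' h) (Sum.inr (Sum.inr p)) s) q)
      (if q = p then Complex.I else 0) t := by
  have e : ∀ s, gainsOf (Function.update (pack κ' h) (Sum.inr (Sum.inr p)) s) q =
      (h q).re + (Function.update (fun q => (h q).im) p s q : ℝ) * Complex.I := fun s => by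
    apply Complex.ext <;> by_cases hq : q = p <;> simp [gainsOf, pack, hq, Function.update_apply]
  simp_rw [e]
  refine (((hasDerivAt_update_apply _ p q t).ofReal_comp.mul_const _).const_add _).congr_deriv ?_
  split_ifs <;> simp

/-- Partial derivatives in the gains of a mean which is linear in them. -/
theorem hasDerivAt_mulVec_gainsOf {I : Type*} [Fintype Q] (Γ : Matrix I Q ℂ) (Ξ : I → Matrix ι Q ℂ)
    (κ' : ι → ℝ) (h : Q → ℂ) (p : Q ⊕ Q) (i : I) (t : ℝ) :
    HasDerivAt (fun s => (Γ *ᵥ gainsOf (Function.update (pack κ' h) (Sum.inr p) s)) i)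
      (linPartials Γ Ξ h (Sum.inr p) i) t := by
  rcases p with p | p
  · refine (HasDerivAt.fun_sum fun q _ =>
      (hasDerivAt_gainsOf_re κ' h p q t).const_mul (Γ i q)).congr_deriv ?_
    simp [linPartials]
  · refine (HasDerivAt.fun_sum fun q _ =>
      (hasDerivAt_gainsOf_im κ' h p q t).const_mul (Γ i q)).congr_deriv ?_
    simp [linPartials, mul_comm]

end Parameters

theorem hasDerivAt_mulVec_chanG (hκ : RegularGeometry S κ) (k : Coord N L₁ L₂) (tied : Bool)
    (g : GainIdx N L₁ → ℂ) (n : Fin N) (s : Fin NS) (m : Fin M) (i : Fin NR) :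
    HasDerivAt (fun x => ((risMat θ *
        chanG S (if tied then Function.update κ k x else κ) n s NT NR g) *ᵥ w n s m) i)
      (if tied then ((risMat θ * dChanG S κ n s NT NR g k) *ᵥ w n s m) i else 0) (κ k) := by
  cases tied
  · simpa using hasDerivAt_const (κ k) _
  · simp only [if_true, risMat, Matrix.mulVec, dotProduct, Matrix.diagonal_mul]
    exact HasDerivAt.fun_sum fun a _ => ((hasDerivAt_chanG hκ k n s g i a).const_mul _).mul_const _

theorem hasDerivAt_chanH_mul (hκ : RegularGeometry S κ) (k : Coord N L₁ L₂) (tied : Bool)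
    (h : GainIdx N L₂ → ℂ) (n : Fin N) (s : Fin NS) (r : Fin NU) (i : Fin NR) :
    HasDerivAt (fun x =>
        (chanH S (if tied then Function.update κ k x else κ) n s NR NU h * risMat θ) r i)
      (if tied then (dChanH S κ n s NR NU h k * risMat θ) r i else 0) (κ k) := by
  cases tied
  · simpa using hasDerivAt_const (κ k) _
  · simp only [if_true, risMat, Matrix.mul_diagonal]
    exact (hasDerivAt_chanH hκ k n s h r i).mul_const _

variable {ι : Type*} [DecidableEq ι] {e : ι → Coord N L₁ L₂}

/-- For a location parameter this is the product rule: the coefficients of `H` always vary, and `G`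
contributes its own term only when `tied`. For a gain it is linearity. -/
theorem hasPartials_meanGivenG (hκ : RegularGeometry S κ) (he : Function.Injective e)
    (tied : Bool) (g : GainIdx N L₁ → ℂ) (h : GainIdx N L₂ → ℂ) :
    HasPartials (meanGivenG (NU := NU) S θ w κ e tied g) (pack (κ ∘ e) h)
      (linPartials (gammaMat S θ w κ g) (xiMat S θ w κ e tied g) h) := by
  rintro (k | p) ⟨n, s, m, r⟩
  · simp only [meanGivenG, locOf_update_inl he, gainsOf_update_inl, gainsOf_pack,
      signal_eq_sum_coefH]
    refine (HasDerivAt.fun_sum fun l _ => (HasDerivAt.fun_sum fun i _ =>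
      (hasDerivAt_coefH hκ (e k) n s l r i).mul
        (hasDerivAt_mulVec_chanG hκ (e k) tied g n s m i)).mul_const (h (n, l))).congr_deriv ?_
    -- The unconjugated row derivative gets an opaque name, so that the sum over all gains collapses
    -- to the block of station `n` before the terms are compared.
    obtain ⟨F, hF⟩ : ∃ F : Fin (L₂ + 1) → ℂ, ∀ l, F l =
        ∑ i, coefH S κ n s NR NU l r i * logDH S κ n s (e k) l r i *
            ((risMat θ * chanG S κ n s NT NR g) *ᵥ w n s m) i +
          if tied then ∑ i, coefH S κ n s NR NU l r i *
            ((risMat θ * dChanG S κ n s NT NR g (e k)) *ᵥ w n s m) i else 0 := ⟨_, fun _ => rfl⟩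
    have hΞ : ∀ q, conj (xiMat S θ w κ e tied g (n, s, m, r) k q) =
        if q.1 = n then F q.2 else 0 := by
      rintro ⟨n', l⟩
      simp only [xiMat, Matrix.of_apply, apply_ite conj, Complex.conj_conj, map_zero, hF]
    simp only [linPartials, Sum.elim_inl, hΞ]
    rw [sum_gainIdx_ite n F]
    refine Finset.sum_congr rfl fun l _ => congrArg (· * h (n, l)) ?_
    rw [hF]
    cases tied <;> simp [Finset.sum_add_distrib]
  -- Along a gain direction the locations keep their true values, so both readings coincide and the
  -- mean is `Γ` applied to the gains.
  · simp only [meanGivenG, locOf_update_inr, locOf_pack, ite_self, signal_eq_gammaMat_mulVec]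
    exact hasDerivAt_mulVec_gainsOf _ _ _ _ _ _ _

theorem hasPartials_meanGivenH (hκ : RegularGeometry S κ) (he : Function.Injective e)
    (tied : Bool) (h : GainIdx N L₂ → ℂ) (g : GainIdx N L₁ → ℂ) :
    HasPartials (meanGivenH (NU := NU) S θ w κ e tied h) (pack (κ ∘ e) g)
      (linPartials (lambdaMat S θ w κ h) (psiMat S θ w κ e tied h) g) := by
  rintro (k | p) ⟨n, s, m, r⟩
  · simp only [meanGivenH, locOf_update_inl he, gainsOf_update_inl, gainsOf_pack,
      signal_eq_sum_coefG]
    refine (HasDerivAt.fun_sum fun l _ => (HasDerivAt.fun_sum fun i _ =>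
      (hasDerivAt_chanH_mul hκ (e k) tied h n s r i).mul (HasDerivAt.fun_sum fun a _ =>
        (hasDerivAt_coefG hκ (e k) n s l i a).mul_const (w n s m a))).mul_const
          (g (n, l))).congr_deriv ?_
    obtain ⟨F, hF⟩ : ∃ F : Fin (L₁ + 1) → ℂ, ∀ l, F l =
        ∑ i, (chanH S κ n s NR NU h * risMat θ) r i *
            ∑ a, coefG S κ n s NT NR l i a * logDG S κ n s (e k) l i a * w n s m a +
          if tied then ∑ i, (dChanH S κ n s NR NU h (e k) * risMat θ) r i *
            ∑ a, coefG S κ n s NT NR l i a * w n s m a else 0 := ⟨_, fun _ => rfl⟩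
    have hΨ : ∀ q, conj (psiMat S θ w κ e tied h (n, s, m, r) k q) =
        if q.1 = n then F q.2 else 0 := by
      rintro ⟨n', l⟩
      simp only [psiMat, Matrix.of_apply, apply_ite conj, Complex.conj_conj, map_zero, hF]
    simp only [linPartials, Sum.elim_inl, hΨ]
    rw [sum_gainIdx_ite n F]
    refine Finset.sum_congr rfl fun l _ => congrArg (· * g (n, l)) ?_
    rw [hF]
    cases tied <;> simp [Finset.sum_add_distrib, add_comm]
  · simp only [meanGivenH, locOf_update_inr, locOf_pack, ite_self, signal_eq_lambdaMat_mulVec]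
    exact hasDerivAt_mulVec_gainsOf _ _ _ _ _ _ _

end SignalModel

end

/-! ### The abstract bounds applied to the two channel models -/

theorem theorem1 {N NS M NT NR NU L₁ L₂ : ℕ} (S : RISSystem N)
    (θ : Fin NR → ℝ) (w : Fin N → Fin NS → Fin M → Fin NT → ℂ)
    (κ : Coord N L₁ L₂ → ℝ) (hκ : RegularGeometry S κ)
    (σsq : Fin N → ℝ) (hσ : ∀ n, 0 < σsq n)
    {ι₁ ι₂ : Type*} [Fintype ι₁] [DecidableEq ι₁] [Fintype ι₂] [DecidableEq ι₂]
    (e₁ : ι₁ → Coord N L₁ L₂) (he₁ : Function.Injective e₁)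
    (e₂ : ι₂ → Coord N L₁ L₂) (he₂ : Function.Injective e₂) (tied : Bool) :
    -- the received signal is linear in each of the two gain vectors
    (∀ (h : GainIdx N L₂ → ℂ) (g : GainIdx N L₁ → ℂ),
      (signal S θ w κ κ h g : Obs N NS M NU → ℂ) = gammaMat S θ w κ g *ᵥ h ∧
      (signal S θ w κ κ h g : Obs N NS M NU → ℂ) = lambdaMat S θ w κ h *ᵥ g) ∧
    -- given `g`: unknown location parameters `κ₂` and gains `h`
    (∀ g : GainIdx N L₁ → ℂ,
      (∀ h : GainIdx N L₂ → ℂ,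
        fisherJ NU S θ w κ σsq e₂ tied g h =
          explicitFIM (noiseVar σsq) (gammaMat (NU := NU) S θ w κ g) (xiMat S θ w κ e₂ tied g) h ∧
        (IsUnit (fisherJ NU S θ w κ σsq e₂ tied g h) →
          ∀ est, UnbiasedOne NU S θ w κ σsq e₂ tied g h est →
            ENNReal.ofReal (crlbOne NU S θ w κ σsq e₂ tied g h) ≤
              mseOne NU S θ w κ σsq e₂ tied g h est)) ∧
      (∀ (ν : Measure (GainIdx N L₂ → ℂ)) [IsProbabilityMeasure ν] (τsq : GainIdx N L₂ → ℝ),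
        (∀ p, 0 < τsq p) → (∀ p, ν.map (fun h => h p) = cnLaw 0 (τsq p)) →
        -- the expected information matrix
        (∀ p q, Integrable (fun h => fisherJ NU S θ w κ σsq e₂ tied g h p q) ν ∧
          ∫ h, fisherJ NU S θ w κ σsq e₂ tied g h p q ∂ν =
            averagedJ NU S θ w κ σsq e₂ tied g ν p q) ∧
        ((∀ᵐ h ∂ν, IsUnit (fisherJ NU S θ w κ σsq e₂ tied g h)) →
          IsUnit (averagedJ NU S θ w κ σsq e₂ tied g ν) ∧
          -- Jensen: `E[J⁻¹] ⪰ (E[J])⁻¹`, where the left-hand side may be infinite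
          (∀ z, ENNReal.ofReal (z ⬝ᵥ ((averagedJ NU S θ w κ σsq e₂ tied g ν)⁻¹ *ᵥ z)) ≤
            ∫⁻ h, ENNReal.ofReal
              (z ⬝ᵥ ((fisherJ NU S θ w κ σsq e₂ tied g h)⁻¹ *ᵥ z)) ∂ν) ∧
          ENNReal.ofReal ((averagedJ NU S θ w κ σsq e₂ tied g ν)⁻¹.trace) ≤
            ∫⁻ h, ENNReal.ofReal (crlbOne NU S θ w κ σsq e₂ tied g h) ∂ν ∧
          -- the error averaged over gains and noise; `est h` is the estimator applied when the
          -- gains are `h` (one estimator for all gains is the case of a constant family)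
          (∀ est : (GainIdx N L₂ → ℂ) → (Obs N NS M NU → ℂ) →
                ι₂ ⊕ (GainIdx N L₂ ⊕ GainIdx N L₂) → ℝ,
            (∀ᵐ h ∂ν, UnbiasedOne NU S θ w κ σsq e₂ tied g h (est h)) →
            ∫⁻ h, ENNReal.ofReal (crlbOne NU S θ w κ σsq e₂ tied g h) ∂ν ≤
              ∫⁻ h, mseOne NU S θ w κ σsq e₂ tied g h (est h) ∂ν)))) ∧
    -- given `h`: unknown location parameters `κ₁` and gains `g`
    (∀ h : GainIdx N L₂ → ℂ,
      (∀ g : GainIdx N L₁ → ℂ,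
        fisherI NU S θ w κ σsq e₁ tied g h =
          explicitFIM (noiseVar σsq) (lambdaMat (NU := NU) S θ w κ h) (psiMat S θ w κ e₁ tied h) g ∧
        (IsUnit (fisherI NU S θ w κ σsq e₁ tied g h) →
          ∀ est, UnbiasedTwo NU S θ w κ σsq e₁ tied g h est →
            ENNReal.ofReal (crlbTwo NU S θ w κ σsq e₁ tied g h) ≤
              mseTwo NU S θ w κ σsq e₁ tied g h est)) ∧
      (∀ (ν : Measure (GainIdx N L₁ → ℂ)) [IsProbabilityMeasure ν] (τsq : GainIdx N L₁ → ℝ),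
        (∀ p, 0 < τsq p) → (∀ p, ν.map (fun g => g p) = cnLaw 0 (τsq p)) →
        (∀ p q, Integrable (fun g => fisherI NU S θ w κ σsq e₁ tied g h p q) ν ∧
          ∫ g, fisherI NU S θ w κ σsq e₁ tied g h p q ∂ν =
            averagedI NU S θ w κ σsq e₁ tied h ν p q) ∧
        ((∀ᵐ g ∂ν, IsUnit (fisherI NU S θ w κ σsq e₁ tied g h)) →
          IsUnit (averagedI NU S θ w κ σsq e₁ tied h ν) ∧
          (∀ z, ENNReal.ofReal (z ⬝ᵥ ((averagedI NU S θ w κ σsq e₁ tied h ν)⁻¹ *ᵥ z)) ≤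
            ∫⁻ g, ENNReal.ofReal
              (z ⬝ᵥ ((fisherI NU S θ w κ σsq e₁ tied g h)⁻¹ *ᵥ z)) ∂ν) ∧
          ENNReal.ofReal ((averagedI NU S θ w κ σsq e₁ tied h ν)⁻¹.trace) ≤
            ∫⁻ g, ENNReal.ofReal (crlbTwo NU S θ w κ σsq e₁ tied g h) ∂ν ∧
          (∀ est : (GainIdx N L₁ → ℂ) → (Obs N NS M NU → ℂ) →
                ι₁ ⊕ (GainIdx N L₁ ⊕ GainIdx N L₁) → ℝ,
            (∀ᵐ g ∂ν, UnbiasedTwo NU S θ w κ σsq e₁ tied g h (est g)) →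
            ∫⁻ g, ENNReal.ofReal (crlbTwo NU S θ w κ σsq e₁ tied g h) ∂ν ≤
              ∫⁻ g, mseTwo NU S θ w κ σsq e₁ tied g h (est g) ∂ν)))) := by
  have hv : ∀ i : Obs N NS M NU, 0 < noiseVar σsq i := fun i => hσ i.1
  exact ⟨fun h g => ⟨signal_eq_gammaMat_mulVec h g, signal_eq_lambdaMat_mulVec h g⟩,
    fun g => linear_model_information_bounds hv fun h => hasPartials_meanGivenG hκ he₂ tied g h,
    fun h => linear_model_information_bounds hv fun g => hasPartials_meanGivenH hκ he₁ tied h g⟩
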